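/- For a finite group $G$ and a set $A$ of generators of $G$, let $\Gamma(G,A)$ be the Cayley graph (edges join elements that differ by multiplication by an element of $A\cup A^{-1}$), let $S=A\cup A^{-1}$, and let $\psi(g)=\frac{1}{2|S|}\mathbf 1_S(g)+\frac12\mathbf 1_{\{1\}}(g)$ for $g\in G$. Let $T=(\psi(y^{-1}x))_{x,y\in G}$ be the transition matrix of the lazy random walk on $\Gamma(G,A)$, and let $\phi_{n,g_0}=T^n\delta_{g_0}$ be the distribution of the walk after $n$ steps from $g_0\in G$. The mixing time $\mathrm{mix}_{G,A}$ is the smallest positive integer $n$ such that $$\sum_{g\in G}\left|\phi_{n,g_0}(g)-\frac1{|G|}\right|\le\frac12;$$ it does not depend on $g_0$. Call a real number $c$ a diameter exponent if there is a constant $K$ such that $\mathrm{diam}(\Gamma(\mathrm{SL}_2(\mathbb Z/p\mathbb Z),A))\le K(\log p)^c$ for every prime $p$ and every set $A$ of generators of $\mathrm{SL}_2(\mathbb Z/p\mathbb Z)$. Theorem. A diameter exponent exists. For every diameter exponent $c$ there is a constant $C>0$ such that, for every prime $p$ and every set $A$ of generators of $G=\mathrm{SL}_2(\mathbb Z/p\mathbb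 Z)$, the mixing time exists and satisfies $$\mathrm{mix}_{G,A}\le C\,|A|\,(\log p)^{2c+1}.$$ In particular, $\mathrm{mix}_{G,A}=O(|A|(\log p)^{2c+1})$ with $c$ and the implied constant absolute. -/

import Mathlib

open scoped Pointwise Matrix

noncomputable section

/-- The step distribution of the lazy random walk attached to a finite set `A` of a group: with
probability `1/2` stay in place, with probability `1/2` multiply by a uniformly random element
of `A ∪ A⁻¹`. -/
def lazyStep {G : Type*} [Group G] [DecidableEq G] (A : Finset G) (g : G) : ℝ :=
  (if g ∈ A ∪ A⁻¹ then 1 / (2 * ((A ∪ A⁻¹).card : ℝ)) else 0) + (if g = 1 then 1 / 2 else 0)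

/-- The transition matrix `(ψ (y⁻¹ x))_{x, y}` of the walk with step distribution `ψ`. -/
def transitionMatrix {G : Type*} [Group G] (ψ : G → ℝ) : Matrix G G ℝ :=
  Matrix.of fun x y => ψ (y⁻¹ * x)

/-- The distribution after `n` steps of the lazy random walk on the Cayley graph of `G` with
respect to `A`, started at `g₀`. -/
def walkDistribution {G : Type*} [Group G] [Fintype G] [DecidableEq G] (A : Finset G) (n : ℕ)
    (g₀ : G) : G → ℝ :=
  (transitionMatrix (lazyStep A) ^ n) *ᵥ (Pi.single g₀ 1)

/-- `t` is the mixing time of the lazy random walk: from every starting point `g₀`, `t` is the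
smallest positive integer `n` for which the distribution after `n` steps is within `1/2` of the
uniform distribution in the `ℓ¹` norm. -/
def IsMixingTime {G : Type*} [Group G] [Fintype G] [DecidableEq G] (A : Finset G) (t : ℕ) :
    Prop :=
  ∀ g₀ : G, IsLeast
    {n : ℕ | 0 < n ∧ ∑ g : G, |walkDistribution A n g₀ g - 1 / (Fintype.card G : ℝ)| ≤ 1 / 2} t

/-- The Cayley graphs of `SL₂(ℤ/pℤ)` have diameter `O((log p) ^ c)`, uniformly in the prime `p` and
in the set `A` of generators. (Such a graph is finite and connected, so `SimpleGraph.diam`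
is its actual diameter.) -/
def IsDiameterExponent (c : ℝ) : Prop :=
  ∃ K : ℝ, ∀ (p : ℕ) [Fact p.Prime] (A : Finset (Matrix.SpecialLinearGroup (Fin 2) (ZMod p))),
    Subgroup.closure (A : Set (Matrix.SpecialLinearGroup (Fin 2) (ZMod p))) = ⊤ →
      ((SimpleGraph.mulCayley
        (A : Set (Matrix.SpecialLinearGroup (Fin 2) (ZMod p)))).diam : ℝ) ≤ K * Real.log p ^ c

end

/-! The proof has two independent halves: a contraction estimate for the walk in terms of the
diameter, and a polylogarithmic diameter bound coming from growth of product sets.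

Mixing. For mean-zero f, the energies ‖f(·g) − f‖² average to 2‖f‖² over g in G. By the triangle
inequality, an element of word length at most D has energy at most D² times the total energy of the
generators. With k = |S| and P the averaging operator over S, this says ‖f‖² ≤ kD²(‖f‖² − ⟨f, Pf⟩).
Since T = (1 + P)/2, it follows that ‖Tf‖² ≤ (1 − 1/(2kD²))‖f‖² without diagonalising anything
(`sum_mulVec_sq_le`). Cauchy–Schwarz passes to ℓ¹ at the price of a factor log |G| = O(log p) in the
time.

Diameter. The engine is `growth`. Within boundedly many steps a generating set contains a regular
semisimple g and a bounded set of conjugators in general position. A Larsen–Pink count then bounds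
elements of constant trace by the 2/3 power of a product set, so centralizers of noncentral elements
of A² meet A² in many points. Pivoting finishes: either some conjugate of the centralizer of g meets
A² noncentrally while a neighbouring one does not, and multiplying A by a piece of centralizer is
almost injective; or all conjugates meet it, and double counting makes A large relative to the
field. Once |A| exceeds q^(11/4), a sum-product argument in the unipotent subgroup fills the group
in 64 steps (`pow_eq_univ_of_large`); below that size, |A^24| ≥ |A|^(56/55). Iterating about log log
p times gives the exponent log 24 / log (56/55). -/

namespace LazyWalk

/-! ### Contraction and mixing of the lazy walk on a finite group -/

section Mixing

variable {G : Type*} [Group G] [Fintype G]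

/-- The squared `ℓ²` distance between `f` and its right translate by `g`. -/
def shiftEnergy (f : G → ℝ) (g : G) : ℝ := ∑ x, (f (x * g) - f x) ^ 2

theorem shiftEnergy_nonneg (f : G → ℝ) (g : G) : 0 ≤ shiftEnergy f g :=
  Finset.sum_nonneg fun _ _ => sq_nonneg _

theorem sum_mul_right_sq (f : G → ℝ) (g : G) : ∑ x, f (x * g) ^ 2 = ∑ x, f x ^ 2 :=
  Fintype.sum_equiv (Equiv.mulRight g) _ _ fun _ => rfl

theorem shiftEnergy_eq (f : G → ℝ) (g : G) :
    shiftEnergy f g = 2 * ∑ x, f x ^ 2 - 2 * ∑ x, f x * f (x * g) := by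
  have h : shiftEnergy f g = ∑ x, f (x * g) ^ 2 + ∑ x, f x ^ 2 - 2 * ∑ x, f x * f (x * g) := by
    rw [shiftEnergy, Finset.mul_sum, ← Finset.sum_add_distrib, ← Finset.sum_sub_distrib]
    exact Finset.sum_congr rfl fun x _ => by ring
  rw [h, sum_mul_right_sq]; ring

/-- Minkowski applied to f(xgh) − f(x) = (f(xgh) − f(xg)) + (f(xg) − f(x)); reindexing x ↦ xg
identifies the first part. -/
theorem sqrt_shiftEnergy_mul_le (f : G → ℝ) (g h : G) :
    √(shiftEnergy f (g * h)) ≤ √(shiftEnergy f g) + √(shiftEnergy f h) := by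
  have key : ∀ v : G → ℝ, √(∑ x, v x ^ 2) = ‖(WithLp.toLp 2 v : EuclideanSpace ℝ G)‖ := by
    intro v
    simp [EuclideanSpace.norm_eq]
  have h2 : shiftEnergy f h = ∑ x, (f (x * (g * h)) - f (x * g)) ^ 2 :=
    (Fintype.sum_equiv (Equiv.mulRight g) _ _ fun x => by simp [mul_assoc]).symm
  rw [h2, shiftEnergy, shiftEnergy, key, key, key]
  refine le_trans (le_of_eq ?_) (norm_add_le _ _)
  congr 1
  ext x
  simp

/-- The cross terms vanish: summing f(x) f(xg) over g gives f(x) times the total sum of f. -/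
theorem sum_shiftEnergy (f : G → ℝ) (hf : ∑ x, f x = 0) :
    ∑ g, shiftEnergy f g = 2 * Fintype.card G * ∑ x, f x ^ 2 := by
  simp only [shiftEnergy_eq]
  rw [Finset.sum_sub_distrib, ← Finset.mul_sum (f := fun g => ∑ x, f x * f (x * g)),
    Finset.sum_comm (f := fun g x => f x * f (x * g))]
  have : ∀ x, ∑ g, f x * f (x * g) = 0 := fun x => by
    rw [← Finset.mul_sum, Fintype.sum_equiv (Equiv.mulLeft x) (fun g => f (x * g)) f fun _ => rfl,
      hf, mul_zero]
  simp only [this, Finset.sum_const, nsmul_eq_mul, Finset.card_univ]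
  simp
  ring

variable [DecidableEq G]

/-- Telescoping along the walk: every edge is labelled by some s in S, and its energy is bounded by
the energy of all of S. -/
theorem sqrt_shiftEnergy_le_length (f : G → ℝ) (A : Finset G) {u v : G}
    (w : (SimpleGraph.mulCayley (A : Set G)).Walk u v) :
    √(shiftEnergy f (u⁻¹ * v)) ≤ w.length * √(∑ s ∈ A ∪ A⁻¹, shiftEnergy f s) := by
  induction w with
  | nil => simp [shiftEnergy]
  | @cons a b c hab w ih =>
    have hs : a⁻¹ * b ∈ A ∪ A⁻¹ := by
      rw [SimpleGraph.mulCayley_adj] at hab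
      rcases hab.2 with h | h
      · exact Finset.mem_union_left _ h
      · refine Finset.mem_union_right _ (Finset.mem_inv'.2 ?_)
        simpa using h
    have h1 : √(shiftEnergy f (a⁻¹ * b)) ≤ √(∑ s ∈ A ∪ A⁻¹, shiftEnergy f s) :=
      Real.sqrt_le_sqrt (Finset.single_le_sum (fun i _ => shiftEnergy_nonneg f i) hs)
    have h2 := sqrt_shiftEnergy_mul_le f (a⁻¹ * b) (b⁻¹ * c)
    have h3 : a⁻¹ * b * (b⁻¹ * c) = a⁻¹ * c := by group
    rw [h3] at h2
    rw [SimpleGraph.Walk.length_cons]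
    push_cast
    linarith

theorem shiftEnergy_le (f : G → ℝ) (A : Finset G) (D : ℕ)
    (hconn : (SimpleGraph.mulCayley (A : Set G)).Connected)
    (hD : ∀ u v, (SimpleGraph.mulCayley (A : Set G)).dist u v ≤ D) (g : G) :
    shiftEnergy f g ≤ (D : ℝ) ^ 2 * ∑ s ∈ A ∪ A⁻¹, shiftEnergy f s := by
  obtain ⟨w, hw⟩ := hconn.exists_walk_length_eq_dist 1 g
  have h := sqrt_shiftEnergy_le_length f A w
  have h0 : 0 ≤ ∑ s ∈ A ∪ A⁻¹, shiftEnergy f s :=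
    Finset.sum_nonneg fun i _ => shiftEnergy_nonneg f i
  have h1 : (w.length : ℝ) ≤ D := by exact_mod_cast hw ▸ hD 1 g
  have h2 : √(shiftEnergy f g) ≤ D * √(∑ s ∈ A ∪ A⁻¹, shiftEnergy f s) := by
    simpa using h.trans (mul_le_mul_of_nonneg_right h1 (Real.sqrt_nonneg _))
  calc shiftEnergy f g = √(shiftEnergy f g) ^ 2 := (Real.sq_sqrt (shiftEnergy_nonneg f g)).symm
    _ ≤ (D * √(∑ s ∈ A ∪ A⁻¹, shiftEnergy f s)) ^ 2 := by gcongr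
    _ = _ := by rw [mul_pow, Real.sq_sqrt h0]

/-- The averaging operator of the simple random walk. -/
noncomputable def average (A : Finset G) (f : G → ℝ) (x : G) : ℝ :=
  ((A ∪ A⁻¹).card : ℝ)⁻¹ * ∑ s ∈ A ∪ A⁻¹, f (x * s)

/-- Substituting y = xs gives f(xs) the weight ψ(s⁻¹); the symmetry of S removes the inverse. -/
theorem sum_lazyStep_eq (A : Finset G) (f : G → ℝ) (x : G) :
    (transitionMatrix (lazyStep A) *ᵥ f) x = (f x + average A f x) / 2 := by
  have hS : (A ∪ A⁻¹)⁻¹ = A ∪ A⁻¹ := by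
    ext y; simp [Finset.mem_inv', or_comm]
  have h1 : (transitionMatrix (lazyStep A) *ᵥ f) x = ∑ s, lazyStep A s⁻¹ * f (x * s) := by
    simp only [Matrix.mulVec, dotProduct, transitionMatrix, Matrix.of_apply]
    exact (Fintype.sum_equiv (Equiv.mulLeft x) _ _ fun s => by simp).symm
  rw [h1]
  have h2 : ∀ s, (s⁻¹ ∈ A ∪ A⁻¹ ↔ s ∈ A ∪ A⁻¹) := fun s => by
    rw [← Finset.mem_inv', hS]
  simp only [lazyStep, h2, add_mul, Finset.sum_add_distrib, ite_mul, zero_mul, inv_eq_one]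
  rw [Finset.sum_ite_eq' Finset.univ (1 : G), ← Finset.sum_filter, ← Finset.mul_sum, average,
    Finset.filter_univ_mem]
  simp
  ring

theorem sum_mulVec (A : Finset G) (hA : A.Nonempty) (f : G → ℝ) :
    ∑ x, (transitionMatrix (lazyStep A) *ᵥ f) x = ∑ x, f x := by
  have hk : ((A ∪ A⁻¹).card : ℝ) ≠ 0 := by
    have : (A ∪ A⁻¹).Nonempty := hA.mono Finset.subset_union_left
    exact_mod_cast this.card_pos.ne'
  simp only [sum_lazyStep_eq]
  rw [← Finset.sum_div, Finset.sum_add_distrib]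
  have : ∑ x, average A f x = ∑ x, f x := by
    simp only [average]
    rw [← Finset.mul_sum, Finset.sum_comm]
    have : ∀ s, ∑ x, f (x * s) = ∑ x, f x := fun s =>
      Fintype.sum_equiv (Equiv.mulRight s) _ _ fun _ => rfl
    simp only [this, Finset.sum_const, nsmul_eq_mul]
    field_simp
  rw [this]; ring

theorem sum_average_sq_le (A : Finset G) (hA : A.Nonempty) (f : G → ℝ) :
    ∑ x, average A f x ^ 2 ≤ ∑ x, f x ^ 2 := by
  have hk : (0 : ℝ) < ((A ∪ A⁻¹).card : ℝ) := by
    have : (A ∪ A⁻¹).Nonempty := hA.mono Finset.subset_union_left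
    exact_mod_cast this.card_pos
  have h1 : ∀ x, average A f x ^ 2 ≤
      ((A ∪ A⁻¹).card : ℝ)⁻¹ * ∑ s ∈ A ∪ A⁻¹, f (x * s) ^ 2 := by
    intro x
    have := sq_sum_le_card_mul_sum_sq (s := A ∪ A⁻¹) (f := fun s => f (x * s))
    rw [average, mul_pow]
    calc _ ≤ (((A ∪ A⁻¹).card : ℝ)⁻¹) ^ 2 *
          ((A ∪ A⁻¹).card * ∑ s ∈ A ∪ A⁻¹, f (x * s) ^ 2) := by gcongr
      _ = _ := by field_simp
  calc _ ≤ ∑ x, ((A ∪ A⁻¹).card : ℝ)⁻¹ * ∑ s ∈ A ∪ A⁻¹, f (x * s) ^ 2 :=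
        Finset.sum_le_sum fun x _ => h1 x
    _ = _ := by
      rw [← Finset.mul_sum, Finset.sum_comm]
      simp only [sum_mul_right_sq, Finset.sum_const, nsmul_eq_mul]
      field_simp

/-- Summing `shiftEnergy_le` over all g gives the Poincaré inequality `hP'`. Laziness enters through
‖Pf‖² ≤ ‖f‖²: it gives ‖Tf‖² ≤ (‖f‖² + ⟨f, Pf⟩)/2, so eigenvalues of P near −1 do no harm. -/
theorem sum_mulVec_sq_le (A : Finset G) (hA : A.Nonempty) (D : ℕ) (hD0 : 0 < D)
    (hconn : (SimpleGraph.mulCayley (A : Set G)).Connected)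
    (hD : ∀ u v, (SimpleGraph.mulCayley (A : Set G)).dist u v ≤ D)
    (f : G → ℝ) (hf : ∑ x, f x = 0) :
    ∑ x, (transitionMatrix (lazyStep A) *ᵥ f) x ^ 2 ≤
      (1 - 1 / (2 * (A ∪ A⁻¹).card * (D : ℝ) ^ 2)) * ∑ x, f x ^ 2 := by
  have hk : (0 : ℝ) < ((A ∪ A⁻¹).card : ℝ) := by
    have : (A ∪ A⁻¹).Nonempty := hA.mono Finset.subset_union_left
    exact_mod_cast this.card_pos
  have hDp : (0 : ℝ) < D := by exact_mod_cast hD0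
  have hG : (0 : ℝ) < Fintype.card G := by exact_mod_cast Fintype.card_pos
  set k : ℝ := ((A ∪ A⁻¹).card : ℝ) with hkdef
  have hM : ∑ s ∈ A ∪ A⁻¹, shiftEnergy f s =
      2 * k * (∑ x, f x ^ 2 - ∑ x, f x * average A f x) := by
    simp only [shiftEnergy_eq, average]
    rw [Finset.sum_sub_distrib, ← Finset.mul_sum (f := fun s => ∑ x, f x * f (x * s)),
      Finset.sum_comm (f := fun s x => f x * f (x * s))]
    simp only [← Finset.mul_sum, Finset.sum_const, nsmul_eq_mul, ← hkdef]
    have : ∑ x, f x * (k⁻¹ * ∑ s ∈ A ∪ A⁻¹, f (x * s)) =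
        k⁻¹ * ∑ x, f x * ∑ s ∈ A ∪ A⁻¹, f (x * s) := by
      rw [Finset.mul_sum]; exact Finset.sum_congr rfl fun x _ => by ring
    rw [this]
    field_simp
  have hP : 2 * Fintype.card G * ∑ x, f x ^ 2 ≤
      Fintype.card G * ((D : ℝ) ^ 2 * ∑ s ∈ A ∪ A⁻¹, shiftEnergy f s) := by
    rw [← sum_shiftEnergy f hf]
    calc _ ≤ ∑ _g : G, (D : ℝ) ^ 2 * ∑ s ∈ A ∪ A⁻¹, shiftEnergy f s :=
          Finset.sum_le_sum fun g _ => shiftEnergy_le f A D hconn hD g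
      _ = _ := by simp
  rw [hM] at hP
  have hP' : ∑ x, f x ^ 2 ≤
      (D : ℝ) ^ 2 * k * (∑ x, f x ^ 2 - ∑ x, f x * average A f x) := by
    have : (Fintype.card G : ℝ) * (2 * ∑ x, f x ^ 2) ≤ Fintype.card G *
        (2 * ((D : ℝ) ^ 2 * k * (∑ x, f x ^ 2 - ∑ x, f x * average A f x))) := by linarith
    have := le_of_mul_le_mul_left this hG
    linarith
  have hT : ∑ x, (transitionMatrix (lazyStep A) *ᵥ f) x ^ 2 =
      (∑ x, f x ^ 2 + 2 * ∑ x, f x * average A f x + ∑ x, average A f x ^ 2) / 4 := by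
    simp only [sum_lazyStep_eq]
    rw [Finset.mul_sum, ← Finset.sum_add_distrib, ← Finset.sum_add_distrib, Finset.sum_div]
    exact Finset.sum_congr rfl fun x _ => by ring
  have hJ := sum_average_sq_le A hA f
  have h5 : 1 / (2 * k * (D : ℝ) ^ 2) * ∑ x, f x ^ 2 ≤
      (∑ x, f x ^ 2 - ∑ x, f x * average A f x) / 2 := by
    rw [div_mul_eq_mul_div, one_mul, div_le_iff₀ (by positivity)]
    linarith
  rw [hT, sub_mul, one_mul]
  linarith

theorem walkDistribution_eq (A : Finset G) (n : ℕ) (g₀ g : G) :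
    walkDistribution A n g₀ g = (transitionMatrix (lazyStep A) ^ n) g g₀ := by
  simp [walkDistribution]

theorem transitionMatrix_pow_mul_left (ψ : G → ℝ) (n : ℕ) (h x y : G) :
    (transitionMatrix ψ ^ n) (h * x) (h * y) = (transitionMatrix ψ ^ n) x y := by
  induction n generalizing x y with
  | zero => simp [Matrix.one_apply]
  | succ n ih =>
    rw [pow_succ, Matrix.mul_apply, Matrix.mul_apply]
    refine (Fintype.sum_equiv (Equiv.mulLeft h) _ _ fun z => ?_).symm
    simp only [Equiv.coe_mulLeft, ih]
    simp [transitionMatrix, mul_assoc]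

/-- Left multiplication commutes with the walk, so the starting point is irrelevant. -/
theorem sum_walkDistribution_translate (A : Finset G) (n : ℕ) (g₀ : G) :
    ∑ g, |walkDistribution A n g₀ g - 1 / (Fintype.card G : ℝ)| =
      ∑ g, |walkDistribution A n 1 g - 1 / (Fintype.card G : ℝ)| := by
  refine (Fintype.sum_equiv (Equiv.mulLeft g₀) _ _ fun g => ?_).symm
  simp only [walkDistribution_eq, Equiv.coe_mulLeft]
  conv_rhs => rw [← mul_one g₀, mul_assoc, one_mul]
  rw [transitionMatrix_pow_mul_left]

theorem mulVec_const (A : Finset G) (hA : A.Nonempty) (c : ℝ) :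
    transitionMatrix (lazyStep A) *ᵥ (fun _ => c) = fun _ => c := by
  have hk : ((A ∪ A⁻¹).card : ℝ) ≠ 0 := by
    have : (A ∪ A⁻¹).Nonempty := hA.mono Finset.subset_union_left
    exact_mod_cast this.card_pos.ne'
  ext x
  rw [sum_lazyStep_eq, average, Finset.sum_const, nsmul_eq_mul]
  field_simp
  ring

theorem walkDistribution_succ (A : Finset G) (n : ℕ) (g₀ : G) :
    walkDistribution A (n + 1) g₀ =
      transitionMatrix (lazyStep A) *ᵥ walkDistribution A n g₀ := by
  rw [walkDistribution, walkDistribution, pow_succ', Matrix.mulVec_mulVec]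

theorem sum_walkDistribution_sub_sq_le (A : Finset G) (hA : A.Nonempty) (D : ℕ) (hD0 : 0 < D)
    (hconn : (SimpleGraph.mulCayley (A : Set G)).Connected)
    (hD : ∀ u v, (SimpleGraph.mulCayley (A : Set G)).dist u v ≤ D) (n : ℕ) :
    ∑ g, (walkDistribution A n 1 g - 1 / (Fintype.card G : ℝ)) = 0 ∧
    ∑ g, (walkDistribution A n 1 g - 1 / (Fintype.card G : ℝ)) ^ 2 ≤
      (1 - 1 / (2 * (A ∪ A⁻¹).card * (D : ℝ) ^ 2)) ^ n := by
  have hk : (1 : ℝ) ≤ ((A ∪ A⁻¹).card : ℝ) := by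
    have : (A ∪ A⁻¹).Nonempty := hA.mono Finset.subset_union_left
    exact_mod_cast this.card_pos
  have hDp : (1 : ℝ) ≤ D := by exact_mod_cast hD0
  have hG : (1 : ℝ) ≤ Fintype.card G := by exact_mod_cast Fintype.card_pos
  have hlam : 0 ≤ 1 - 1 / (2 * (A ∪ A⁻¹).card * (D : ℝ) ^ 2) := by
    have h1 : 1 ≤ 2 * ((A ∪ A⁻¹).card : ℝ) * (D : ℝ) ^ 2 := by
      have := one_le_pow₀ hDp (n := 2)
      nlinarith
    rw [sub_nonneg, div_le_one (by linarith)]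
    exact h1
  induction n with
  | zero =>
    have h0 : walkDistribution A 0 (1 : G) = Pi.single 1 1 := by
      ext g
      simp [walkDistribution_eq, Matrix.one_apply, Pi.single_apply]
    have hs : ∑ g : G, (Pi.single (1 : G) (1 : ℝ) : G → ℝ) g = 1 := by simp
    have hs2 : ∑ g : G, ((Pi.single (1 : G) (1 : ℝ) : G → ℝ) g) ^ 2 = (1 : ℝ) := by
      refine Eq.trans (Finset.sum_congr rfl fun g _ => ?_) hs
      by_cases h : g = 1 <;> simp [h]
    rw [h0]
    constructor
    · rw [Finset.sum_sub_distrib, hs]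
      simp
    · have : ∑ g : G, ((Pi.single (1 : G) (1 : ℝ) : G → ℝ) g - 1 / (Fintype.card G : ℝ)) ^ 2 =
          1 - 1 / (Fintype.card G : ℝ) := by
        simp only [sub_sq, Finset.sum_add_distrib, Finset.sum_sub_distrib, ← Finset.sum_mul,
          ← Finset.mul_sum, hs, hs2]
        simp
        field_simp
        ring
      rw [this, pow_zero]
      have : 0 ≤ 1 / (Fintype.card G : ℝ) := by positivity
      linarith
  | succ n ih =>
    have h1 : (fun g => walkDistribution A (n + 1) 1 g - 1 / (Fintype.card G : ℝ)) =
        transitionMatrix (lazyStep A) *ᵥ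
          (fun g => walkDistribution A n 1 g - 1 / (Fintype.card G : ℝ)) := by
      have : (fun g => walkDistribution A n 1 g - 1 / (Fintype.card G : ℝ)) =
          walkDistribution A n 1 - fun _ => 1 / (Fintype.card G : ℝ) := rfl
      rw [this, Matrix.mulVec_sub, mulVec_const A hA, ← walkDistribution_succ]
      rfl
    have h2 : ∀ g, walkDistribution A (n + 1) 1 g - 1 / (Fintype.card G : ℝ) =
        (transitionMatrix (lazyStep A) *ᵥ
          (fun g => walkDistribution A n 1 g - 1 / (Fintype.card G : ℝ))) g := congrFun h1
    simp only [h2]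
    refine ⟨by rw [sum_mulVec A hA]; exact ih.1, ?_⟩
    refine (sum_mulVec_sq_le A hA D hD0 hconn hD _ ih.1).trans ?_
    rw [pow_succ' _ n]
    exact mul_le_mul_of_nonneg_left ih.2 hlam

/-- The logarithm makes the squared ℓ² distance at most 1/(4|G|); Cauchy–Schwarz then bounds the
squared ℓ¹ distance by 1/4. -/
theorem sum_abs_walkDistribution_le_half (A : Finset G) (hA : A.Nonempty) (D : ℕ) (hD0 : 0 < D)
    (hconn : (SimpleGraph.mulCayley (A : Set G)).Connected)
    (hD : ∀ u v, (SimpleGraph.mulCayley (A : Set G)).dist u v ≤ D) (n : ℕ)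
    (hn : 2 * (A ∪ A⁻¹).card * (D : ℝ) ^ 2 * Real.log (4 * Fintype.card G) ≤ n) :
    ∑ g, |walkDistribution A n 1 g - 1 / (Fintype.card G : ℝ)| ≤ 1 / 2 := by
  have hk : (0 : ℝ) < ((A ∪ A⁻¹).card : ℝ) := by
    have : (A ∪ A⁻¹).Nonempty := hA.mono Finset.subset_union_left
    exact_mod_cast this.card_pos
  have hDp : (0 : ℝ) < D := by exact_mod_cast hD0
  have hG : (0 : ℝ) < Fintype.card G := by exact_mod_cast Fintype.card_pos
  have h1 := (sum_walkDistribution_sub_sq_le A hA D hD0 hconn hD n).2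
  set L : ℝ := 2 * (A ∪ A⁻¹).card * (D : ℝ) ^ 2 with hL
  have hLpos : 0 < L := by positivity
  have hL1 : 1 ≤ L := by
    have h3 : (1 : ℝ) ≤ ((A ∪ A⁻¹).card : ℝ) := by exact_mod_cast (by exact_mod_cast hk)
    have h4 : (1 : ℝ) ≤ (D : ℝ) ^ 2 := one_le_pow₀ (by exact_mod_cast hD0)
    nlinarith
  have h2 : (1 - 1 / L) ^ n ≤ 1 / (4 * Fintype.card G) := by
    have h3 : 1 - 1 / L ≤ Real.exp (-(1 / L)) := by
      have := Real.add_one_le_exp (-(1 / L)); linarith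
    have h0 : 0 ≤ 1 - 1 / L := by
      rw [sub_nonneg, div_le_one hLpos]; exact hL1
    calc (1 - 1 / L) ^ n ≤ Real.exp (-(1 / L)) ^ n := by gcongr
      _ = Real.exp (-(n / L)) := by rw [← Real.exp_nat_mul]; congr 1; ring
      _ ≤ Real.exp (-Real.log (4 * Fintype.card G)) := by
        rw [Real.exp_le_exp, neg_le_neg_iff, le_div_iff₀ hLpos]
        linarith
      _ = _ := by rw [Real.exp_neg, Real.exp_log (by positivity), one_div]
  have h3 := sq_sum_le_card_mul_sum_sq (s := (Finset.univ : Finset G))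
    (f := fun g => |walkDistribution A n 1 g - 1 / (Fintype.card G : ℝ)|)
  simp only [sq_abs, Finset.card_univ] at h3
  have h4 : (∑ g, |walkDistribution A n 1 g - 1 / (Fintype.card G : ℝ)|) ^ 2 ≤ (1 / 2) ^ 2 :=
    calc _ ≤ _ := h3
      _ ≤ (Fintype.card G : ℝ) * (1 / (4 * Fintype.card G)) := by
        gcongr; exact h1.trans h2
      _ = _ := by field_simp; norm_num
  exact le_of_sq_le_sq h4 (by norm_num)

/-- The lazy random walk on a connected Cayley graph of diameter at most `D` mixes in time
`O(|A| D² log |G|)`. -/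
theorem exists_isMixingTime (A : Finset G) (hA : A.Nonempty) (D : ℕ) (hD0 : 0 < D)
    (hconn : (SimpleGraph.mulCayley (A : Set G)).Connected)
    (hD : ∀ u v, (SimpleGraph.mulCayley (A : Set G)).dist u v ≤ D) :
    ∃ t : ℕ, IsMixingTime A t ∧
      (t : ℝ) ≤ 2 * (A ∪ A⁻¹).card * (D : ℝ) ^ 2 * Real.log (4 * Fintype.card G) + 1 := by
  classical
  set R : ℝ := 2 * (A ∪ A⁻¹).card * (D : ℝ) ^ 2 * Real.log (4 * Fintype.card G) with hR
  have hG : (1 : ℝ) ≤ Fintype.card G := by exact_mod_cast Fintype.card_pos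
  have hlog : 0 < Real.log (4 * Fintype.card G) := Real.log_pos (by linarith)
  have hRpos : 0 < R := by
    have hk : (0 : ℝ) < ((A ∪ A⁻¹).card : ℝ) := by
      have : (A ∪ A⁻¹).Nonempty := hA.mono Finset.subset_union_left
      exact_mod_cast this.card_pos
    have hDp : (0 : ℝ) < D := by exact_mod_cast hD0
    positivity
  have hex : ∃ n : ℕ, 0 < n ∧
      ∑ g : G, |walkDistribution A n 1 g - 1 / (Fintype.card G : ℝ)| ≤ 1 / 2 :=
    ⟨⌈R⌉₊, Nat.ceil_pos.2 hRpos,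
      sum_abs_walkDistribution_le_half A hA D hD0 hconn hD _ (Nat.le_ceil _)⟩
  refine ⟨Nat.find hex, fun g₀ => ?_, ?_⟩
  · simp only [sum_walkDistribution_translate A _ g₀]
    exact ⟨Nat.find_spec hex, fun n hn => Nat.find_min' hex hn⟩
  · have h1 : Nat.find hex ≤ ⌈R⌉₊ := Nat.find_min' hex ⟨Nat.ceil_pos.2 hRpos,
      sum_abs_walkDistribution_le_half A hA D hD0 hconn hD _ (Nat.le_ceil _)⟩
    have h2 : ((Nat.find hex : ℕ) : ℝ) ≤ (⌈R⌉₊ : ℝ) := by exact_mod_cast h1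
    exact h2.trans (Nat.ceil_lt_add_one hRpos.le).le

end Mixing

end LazyWalk

namespace SL2Growth

/-! ### Spans of product sets under a representation -/

section Generation

variable {G : Type*} [Group G] [DecidableEq G]

theorem exists_mem_pow_of_closure_eq_top {A : Finset G} (hinv : A⁻¹ = A)
    (hgen : Subgroup.closure (A : Set G) = ⊤) (g : G) : ∃ n : ℕ, g ∈ A ^ n := by
  have hg : g ∈ Subgroup.closure (A : Set G) := hgen ▸ Subgroup.mem_top g
  induction hg using Subgroup.closure_induction with
  | mem x hx => exact ⟨1, by simpa using hx⟩
  | one => exact ⟨0, by simp⟩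
  | mul x y _ _ hx hy =>
    obtain ⟨m, hm⟩ := hx
    obtain ⟨n, hn⟩ := hy
    exact ⟨m + n, by rw [pow_add]; exact Finset.mul_mem_mul hm hn⟩
  | inv x _ hx =>
    obtain ⟨m, hm⟩ := hx
    refine ⟨m, ?_⟩
    rw [← hinv, inv_pow]
    exact Finset.inv_mem_inv hm

/-- The span of the image of `A ^ n` under a representation stabilises after `dim R` steps. -/
theorem span_image_pow_eq {K R : Type*} [Field K] [Ring R] [Algebra K R] [FiniteDimensional K R]
    (ρ : G →* R) {A : Finset G} (h1 : (1 : G) ∈ A) (hinv : A⁻¹ = A)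
    (hgen : Subgroup.closure (A : Set G) = ⊤) {N : ℕ} (hN : Module.finrank K R ≤ N) :
    Submodule.span K (ρ '' (A ^ N : Finset G)) = Submodule.span K (Set.range ρ) := by
  set W : ℕ → Submodule K R := fun n => Submodule.span K (ρ '' (A ^ n : Finset G)) with hW
  have hmono : Monotone W := fun m n h =>
    Submodule.span_mono (Set.image_mono (Finset.coe_subset.2 (Finset.pow_subset_pow_right h1 h)))
  -- By this recursion one equality `W n = W (n + 1)` propagates forever, so the dimension increases
  -- strictly until it stops.
  have hsucc : ∀ n, W (n + 1) = W n * W 1 := fun n => by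
    simp only [hW, Submodule.span_mul_span, pow_one]
    rw [← Set.image_mul, ← Finset.coe_mul, pow_succ]
  have hfin : ∀ n, W n = W (n + 1) ↔ Module.finrank K (W n) = Module.finrank K (W (n + 1)) :=
    fun n => ⟨fun h => by rw [← h], fun h =>
      Submodule.eq_of_le_of_finrank_eq (hmono n.le_succ) h⟩
  have hst : ∀ n ≥ N, Module.finrank K (W n) = Module.finrank K (W N) := by
    have := fun n (hn : Module.finrank K R ≤ n) => Nat.stabilises_of_monotone
      (f := fun n => Module.finrank K (W n)) (b := Module.finrank K R) (n := n)
      (fun m n h => Submodule.finrank_mono (hmono h)) (fun m => Submodule.finrank_le _)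
      (fun m hm => (hfin _).1 (by rw [hsucc, hsucc (m + 1), (hfin m).2 hm])) hn
    exact fun n hn => (this n (hN.trans hn)).trans (this N hN).symm
  refine le_antisymm (Submodule.span_mono (Set.image_subset_range _ _)) (Submodule.span_le.2 ?_)
  rintro _ ⟨g, rfl⟩
  obtain ⟨n, hn⟩ := exists_mem_pow_of_closure_eq_top hinv hgen g
  have h2 : W N = W (max n N) := Submodule.eq_of_le_of_finrank_eq (hmono (le_max_right _ _))
    (hst _ (le_max_right _ _)).symm
  have h3 : ρ g ∈ W (max n N) := hmono (le_max_left n N)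
    (Submodule.subset_span (Set.mem_image_of_mem _ hn))
  rw [← h2] at h3
  exact h3

/-- Extract a basis of the span from the image of `A ^ N` and lift each basis vector to a group
element. -/
theorem exists_finset_span_image_eq {K R : Type*} [Field K] [Ring R] [Algebra K R]
    [FiniteDimensional K R] (ρ : G →* R) {A : Finset G} (h1 : (1 : G) ∈ A) (hinv : A⁻¹ = A)
    (hgen : Subgroup.closure (A : Set G) = ⊤) {N : ℕ} (hN : Module.finrank K R ≤ N) :
    ∃ F : Finset G, F ⊆ A ^ N ∧ F.card ≤ Module.finrank K R ∧
      Submodule.span K (ρ '' (F : Set G)) = Submodule.span K (Set.range ρ) := by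
  obtain ⟨b, hb, hspan, hli⟩ := exists_linearIndependent K (ρ '' (A ^ N : Finset G))
  have hbf : b.Finite := hli.setFinite
  have hex : ∀ r : R, ∃ g : G, r ∈ b → g ∈ A ^ N ∧ ρ g = r := fun r => by
    by_cases hr : r ∈ b
    · obtain ⟨g, hg, h⟩ := hb hr
      exact ⟨g, fun _ => ⟨hg, h⟩⟩
    · exact ⟨1, fun h => absurd h hr⟩
  choose σ hσ using hex
  refine ⟨hbf.toFinset.image σ, ?_, ?_, ?_⟩
  · intro g hg
    obtain ⟨r, hr, rfl⟩ := Finset.mem_image.1 hg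
    exact (hσ r (hbf.mem_toFinset.1 hr)).1
  · refine Finset.card_image_le.trans ?_
    have : Fintype b := hbf.fintype
    rw [Set.Finite.card_toFinset]
    exact hli.fintype_card_le_finrank
  · rw [← span_image_pow_eq ρ h1 hinv hgen hN, ← hspan]
    congr 1
    rw [Finset.coe_image, Set.image_image, Set.Finite.coe_toFinset]
    ext r
    constructor
    · rintro ⟨r', hr', rfl⟩
      simpa only [(hσ r' hr').2] using hr'
    · exact fun hr => ⟨r, hr, (hσ r hr).2⟩

end Generation

/-- The group `SL₂(K)`. -/
abbrev SL2 (K : Type*) [CommRing K] := Matrix.SpecialLinearGroup (Fin 2) K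

/-- The algebra of `2 × 2` matrices. -/
abbrev M2 (K : Type*) [CommRing K] := Matrix (Fin 2) (Fin 2) K

/-! ### Centralizers and traces in SL₂ -/

section Algebra

variable {K : Type*} [Field K]

/-- The upper unipotent matrices. -/
def upper (s : K) : SL2 K := ⟨!![1, s; 0, 1], by simp [Matrix.det_fin_two_of]⟩

/-- The lower unipotent matrices. -/
def lower (s : K) : SL2 K := ⟨!![1, 0; s, 1], by simp [Matrix.det_fin_two_of]⟩

/-- The Weyl element. -/
def weyl : SL2 K := ⟨!![0, 1; -1, 0], by simp [Matrix.det_fin_two_of]⟩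

theorem det_eq (x : SL2 K) : x 0 0 * x 1 1 - x 0 1 * x 1 0 = 1 := by
  have := x.det_coe
  rwa [Matrix.det_fin_two] at this

theorem inv_val (x : SL2 K) : (x⁻¹).1 = !![x 1 1, -x 0 1; -x 1 0, x 0 0] := by
  rw [Matrix.SpecialLinearGroup.coe_inv, Matrix.adjugate_fin_two]

theorem upper_val (s : K) : (upper s).1 = !![1, s; 0, 1] := rfl

theorem lower_val (s : K) : (lower s).1 = !![1, 0; s, 1] := rfl

theorem weyl_val : (weyl : SL2 K).1 = !![0, 1; -1, 0] := rfl

theorem commute_iff (x y : SL2 K) : x * y = y * x ↔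
    x 0 1 * y 1 0 = y 0 1 * x 1 0 ∧ x 0 0 * y 0 1 + x 0 1 * y 1 1 = y 0 0 * x 0 1 + y 0 1 * x 1 1 ∧
      x 1 0 * y 0 0 + x 1 1 * y 1 0 = y 1 0 * x 0 0 + y 1 1 * x 1 0 := by
  rw [Matrix.SpecialLinearGroup.ext_iff]
  simp only [Fin.forall_fin_two, Matrix.SpecialLinearGroup.coe_mul, Matrix.mul_apply,
    Fin.sum_univ_two]
  constructor
  · rintro ⟨⟨h1, h2⟩, h3, h4⟩
    exact ⟨by linear_combination h1, h2, h3⟩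
  · rintro ⟨h1, h2, h3⟩
    exact ⟨⟨by linear_combination h1, h2⟩, h3, by linear_combination -h1⟩

theorem mem_center_iff_entries (x : SL2 K) :
    x ∈ Subgroup.center (SL2 K) ↔ x 0 1 = 0 ∧ x 1 0 = 0 ∧ x 0 0 = x 1 1 := by
  rw [Subgroup.mem_center_iff]
  constructor
  · intro h
    have h1 := (commute_iff _ _).1 (h (upper 1))
    have h2 := (commute_iff _ _).1 (h (lower 1))
    simp [upper, lower] at h1 h2
    exact ⟨h2.1.symm, h1.1, by linear_combination -h1.2⟩
  · rintro ⟨h1, h2, h3⟩ g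
    rw [commute_iff, h1, h2, h3]
    refine ⟨by ring, by ring, by ring⟩

theorem center_card_le_two (s : Finset (SL2 K))
    (hs : ∀ x ∈ s, x ∈ Subgroup.center (SL2 K)) : s.card ≤ 2 := by
  by_contra! h
  obtain ⟨x, hx, y, hy, z, hz, hxy, hxz, hyz⟩ := Finset.two_lt_card.1 h
  have key : ∀ x ∈ s, x 0 0 ^ 2 = 1 ∧ ∀ y ∈ s, x 0 0 = y 0 0 → x = y := by
    intro x hx
    obtain ⟨h1, h2, h3⟩ := (mem_center_iff_entries x).1 (hs x hx)
    refine ⟨by have := det_eq x; rw [h1, h2, ← h3] at this; linear_combination this, ?_⟩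
    intro y hy hxy
    obtain ⟨h1', h2', h3'⟩ := (mem_center_iff_entries y).1 (hs y hy)
    rw [Matrix.SpecialLinearGroup.ext_iff]
    simp [Fin.forall_fin_two, h1, h2, ← h3, h1', h2', ← h3', hxy]
  rcases sq_eq_sq_iff_eq_or_eq_neg.1 ((key x hx).1.trans (key y hy).1.symm) with h1 | h1
  · exact hxy ((key x hx).2 y hy h1)
  rcases sq_eq_sq_iff_eq_or_eq_neg.1 ((key x hx).1.trans (key z hz).1.symm) with h2 | h2
  · exact hxz ((key x hx).2 z hz h2)
  · exact hyz ((key y hy).2 z hz (neg_injective (h1.symm.trans h2)))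

/-- An element commuting with a noncentral `y` is a linear combination of `1` and `y`. -/
theorem exists_eq_smul_add_smul {x y : SL2 K} (hy : y ∉ Subgroup.center (SL2 K))
    (h : x * y = y * x) : ∃ a b : K, x.1 = a • (1 : M2 K) + b • y.1 := by
  rw [mem_center_iff_entries] at hy
  obtain ⟨h1, h2, h3⟩ := (commute_iff _ _).1 h
  have key : ∀ a b : K, x 0 0 = a + b * y 0 0 → x 0 1 = b * y 0 1 → x 1 0 = b * y 1 0 →
      x 1 1 = a + b * y 1 1 → ∃ a b : K, x.1 = a • (1 : M2 K) + b • y.1 := by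
    intro a b e1 e2 e3 e4
    refine ⟨a, b, ?_⟩
    ext i j
    fin_cases i <;> fin_cases j <;> simp [e1, e2, e3, e4]
  by_cases hb : y 0 1 = 0
  · by_cases hc : y 1 0 = 0
    · have hd : y 0 0 - y 1 1 ≠ 0 := fun e => hy ⟨hb, hc, sub_eq_zero.1 e⟩
      refine key (x 0 0 - (x 0 0 - x 1 1) / (y 0 0 - y 1 1) * y 0 0)
        ((x 0 0 - x 1 1) / (y 0 0 - y 1 1)) ?_ ?_ ?_ ?_
      · ring
      · rw [hb] at h2 ⊢
        have : x 0 1 * (y 0 0 - y 1 1) = 0 := by linear_combination -h2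
        rw [mul_zero]
        exact (mul_eq_zero.1 this).resolve_right hd
      · rw [hc] at h3 ⊢
        have : x 1 0 * (y 0 0 - y 1 1) = 0 := by linear_combination h3
        rw [mul_zero]
        exact (mul_eq_zero.1 this).resolve_right hd
      · field_simp; ring
    · refine key (x 0 0 - x 1 0 / y 1 0 * y 0 0) (x 1 0 / y 1 0) (by ring) ?_ ?_ ?_
      · field_simp; linear_combination h1
      · field_simp
      · field_simp; linear_combination h3
  · refine key (x 0 0 - x 0 1 / y 0 1 * y 0 0) (x 0 1 / y 0 1) (by ring) ?_ ?_ ?_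
    · field_simp
    · field_simp; linear_combination -h1
    · field_simp; linear_combination -h2

/-- Both `x` and `z` are linear polynomials in `y`. -/
theorem commute_trans {x y z : SL2 K} (hy : y ∉ Subgroup.center (SL2 K))
    (hx : x * y = y * x) (hz : z * y = y * z) : x * z = z * x := by
  obtain ⟨a, b, h1⟩ := exists_eq_smul_add_smul hy hx
  obtain ⟨c, d, h2⟩ := exists_eq_smul_add_smul hy hz
  apply Subtype.ext
  rw [Matrix.SpecialLinearGroup.coe_mul, Matrix.SpecialLinearGroup.coe_mul, h1, h2]
  simp only [add_mul, mul_add, Matrix.smul_mul, Matrix.mul_smul, one_mul, mul_one]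
  rw [smul_comm b d]
  simp only [smul_comm c a, smul_comm b c, smul_comm d a]
  abel

theorem det_smul_one_add_smul (a b : K) (y : SL2 K) :
    (a • (1 : M2 K) + b • y.1).det = a ^ 2 + a * b * y.1.trace + b ^ 2 := by
  rw [Matrix.det_fin_two, Matrix.trace_fin_two]
  simp
  linear_combination b ^ 2 * det_eq y

theorem trace_inv (x : SL2 K) : (x⁻¹).1.trace = x.1.trace := by
  rw [inv_val, Matrix.trace_fin_two, Matrix.trace_fin_two]
  simp [add_comm]

theorem trace_conj (g x : SL2 K) : (g * x * g⁻¹).1.trace = x.1.trace := by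
  rw [Matrix.SpecialLinearGroup.coe_mul, Matrix.trace_mul_comm, ← Matrix.SpecialLinearGroup.coe_mul]
  simp

/-- The centralizer of a noncentral element has at most `2 |K|` elements. -/
theorem card_centralizer_le [Fintype K] [DecidableEq K] {y : SL2 K}
    (hy : y ∉ Subgroup.center (SL2 K)) (s : Finset (SL2 K)) (hs : ∀ x ∈ s, x * y = y * x) :
    s.card ≤ 2 * Fintype.card K := by
  have hex : ∀ x : SL2 K, ∃ ab : K × K, x ∈ s → x.1 = ab.1 • (1 : M2 K) + ab.2 • y.1 := by
    intro x
    by_cases hx : x ∈ s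
    · obtain ⟨a, b, h⟩ := exists_eq_smul_add_smul hy (hs x hx)
      exact ⟨(a, b), fun _ => h⟩
    · exact ⟨(0, 0), fun h => absurd h hx⟩
  choose σ hσ using hex
  -- For x = a + by with b fixed, det x = 1 is a monic quadratic equation in a.
  refine Finset.card_le_mul_card_image_of_maps_to (f := fun x => (σ x).2) (t := Finset.univ)
    (fun _ _ => Finset.mem_univ _) 2 fun b _ => ?_
  by_contra! h
  obtain ⟨x₁, h1, x₂, h2, x₃, h3, h12, h13, h23⟩ := Finset.two_lt_card.1 h
  have key : ∀ x ∈ s.filter fun x => (σ x).2 = b, x.1 = (σ x).1 • (1 : M2 K) + b • y.1 ∧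
      (σ x).1 ^ 2 + (σ x).1 * b * y.1.trace + b ^ 2 = 1 := by
    intro x hx
    obtain ⟨hx, hb⟩ := Finset.mem_filter.1 hx
    have e := hσ x hx
    rw [hb] at e
    refine ⟨e, ?_⟩
    rw [← det_smul_one_add_smul, ← e, x.det_coe]
  have hne : ∀ x ∈ s.filter fun x => (σ x).2 = b, ∀ x' ∈ s.filter fun x => (σ x).2 = b,
      x ≠ x' → (σ x).1 + (σ x').1 + b * y.1.trace = 0 := by
    intro x hx x' hx' hne
    have h1 := (key x hx).2
    have h2 := (key x' hx').2
    have h3 : (σ x).1 - (σ x').1 ≠ 0 := fun e => hne (Subtype.ext (by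
      rw [(key x hx).1, (key x' hx').1, sub_eq_zero.1 e]))
    refine (mul_eq_zero.1 (?_ : ((σ x).1 - (σ x').1) * _ = 0)).resolve_left h3
    linear_combination h1 - h2
  have e1 := hne _ h1 _ h2 h12
  have e2 := hne _ h1 _ h3 h13
  refine h23 (Subtype.ext ?_)
  rw [(key _ h2).1, (key _ h3).1]
  congr 2
  linear_combination e1 - e2

/-- The centralizer of a regular semisimple element meets each trace level set in at most two
points. -/
theorem card_trace_eq_le [DecidableEq K] (h2 : (2 : K) ≠ 0) {y : SL2 K}
    (hy : y.1.trace ^ 2 ≠ 4) (hyc : y ∉ Subgroup.center (SL2 K)) (t : K) (s : Finset (SL2 K))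
    (hs : ∀ x ∈ s, x * y = y * x ∧ x.1.trace = t) : s.card ≤ 2 := by
  by_contra! h
  obtain ⟨x₁, h1, x₂, h2', x₃, h3, h12, h13, h23⟩ := Finset.two_lt_card.1 h
  -- Eliminating a between the trace and determinant equations leaves b² up to the nonzero factor 4
  -- − (tr y)²; a is then determined by b because 2 ≠ 0.
  have key : ∀ x ∈ s, ∃ a b : K, x.1 = a • (1 : M2 K) + b • y.1 ∧ 2 * a + b * y.1.trace = t ∧
      b ^ 2 * (4 - y.1.trace ^ 2) = 4 - t ^ 2 := by
    intro x hx
    obtain ⟨a, b, hab⟩ := exists_eq_smul_add_smul hyc (hs x hx).1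
    have e1 : 2 * a + b * y.1.trace = t := by
      rw [← (hs x hx).2, hab]; simp [Matrix.trace_fin_two]; ring
    have e2 : a ^ 2 + a * b * y.1.trace + b ^ 2 = 1 := by
      rw [← det_smul_one_add_smul, ← hab, x.det_coe]
    exact ⟨a, b, hab, e1, by rw [← e1]; linear_combination 4 * e2⟩
  obtain ⟨a₁, b₁, p₁, q₁, r₁⟩ := key _ h1
  obtain ⟨a₂, b₂, p₂, q₂, r₂⟩ := key _ h2'
  obtain ⟨a₃, b₃, p₃, q₃, r₃⟩ := key _ h3
  have hd : (4 - y.1.trace ^ 2) ≠ 0 := fun e => hy (sub_eq_zero.1 e).symm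
  have inj : ∀ {x x' : SL2 K} {a b a' b' : K}, x.1 = a • (1 : M2 K) + b • y.1 →
      x'.1 = a' • (1 : M2 K) + b' • y.1 → 2 * a + b * y.1.trace = t →
      2 * a' + b' * y.1.trace = t → b = b' → x = x' := by
    intro x x' a b a' b' h h' e e' hb
    subst hb
    have : a = a' := mul_left_cancel₀ h2 (by linear_combination e - e')
    exact Subtype.ext (by rw [h, h', this])
  have sq : ∀ {b b' : K}, b ^ 2 * (4 - y.1.trace ^ 2) = 4 - t ^ 2 →
      b' ^ 2 * (4 - y.1.trace ^ 2) = 4 - t ^ 2 → b = b' ∨ b = -b' := fun e e' =>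
    sq_eq_sq_iff_eq_or_eq_neg.1 (mul_right_cancel₀ hd (e.trans e'.symm))
  rcases sq r₁ r₂ with e | e
  · exact h12 (inj p₁ p₂ q₁ q₂ e)
  rcases sq r₁ r₃ with e' | e'
  · exact h13 (inj p₁ p₃ q₁ q₃ e')
  · exact h23 (inj p₂ p₃ q₂ q₃ (neg_injective (e.symm.trans e')))

/-- Nondegeneracy of the trace form, tested on matrix units. -/
theorem eq_zero_of_trace_mul_eq_zero {S : Set (M2 K)} (hS : Submodule.span K S = ⊤) (w : M2 K)
    (hw : ∀ b ∈ S, (b * w).trace = 0) : w = 0 := by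
  have h : ∀ b : M2 K, (b * w).trace = 0 := by
    intro b
    have hb : b ∈ Submodule.span K S := hS ▸ Submodule.mem_top
    induction hb using Submodule.span_induction with
    | mem x hx => exact hw x hx
    | zero => simp
    | add x y _ _ hx hy => rw [add_mul, Matrix.trace_add, hx, hy, add_zero]
    | smul a x _ hx => rw [Matrix.smul_mul, Matrix.trace_smul, hx, smul_zero]
  ext i j
  have := h (Matrix.single j i 1)
  rw [Matrix.trace_single_mul, one_smul] at this
  exact this

/-- If `1` and `S` span the matrix algebra, then at most two elements `x'` of `SL₂(K)` have
prescribed traces `tr (b x⁻¹ x') = tr b` for all `b` in `S`. -/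
theorem eq_or_eq_or_eq_of_trace_eq {S : Set (M2 K)} (hS : Submodule.span K (insert 1 S) = ⊤)
    {x x₁ x₂ : SL2 K} (h1 : ∀ b ∈ S, (b * (x⁻¹ * x₁).1).trace = b.trace)
    (h2 : ∀ b ∈ S, (b * (x⁻¹ * x₂).1).trace = b.trace) : x = x₁ ∨ x = x₂ ∨ x₁ = x₂ := by
  by_contra! h
  obtain ⟨hx1, hx2, h12⟩ := h
  -- Put w = x⁻¹x' − 1, which is trace-orthogonal to S. If also tr w = 0, then w is orthogonal to
  -- everything; and det(1 + w) = 1 reads tr w + det w = 0.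
  have key : ∀ x' : SL2 K, x ≠ x' → (∀ b ∈ S, (b * (x⁻¹ * x').1).trace = b.trace) →
      ((x⁻¹ * x').1 - 1).trace ≠ 0 ∧
        ((x⁻¹ * x').1 - 1).trace + ((x⁻¹ * x').1 - 1).det = 0 := by
    intro x' hne hx'
    constructor
    · intro h0
      have := eq_zero_of_trace_mul_eq_zero hS ((x⁻¹ * x').1 - 1) (by
        intro b hb
        rcases hb with rfl | hb
        · rw [one_mul, h0]
        · rw [mul_sub, Matrix.trace_sub, hx' b hb, mul_one, sub_self])
      exact hne (inv_mul_eq_one.1 (Subtype.ext (sub_eq_zero.1 this)))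
    · have := det_eq (x⁻¹ * x')
      rw [Matrix.trace_fin_two, Matrix.det_fin_two]
      simp only [Matrix.sub_apply, Matrix.one_apply]
      simp
      simp at this
      linear_combination this
  obtain ⟨n1, e1⟩ := key x₁ hx1 h1
  obtain ⟨n2, e2⟩ := key x₂ hx2 h2
  set w₁ := (x⁻¹ * x₁).1 - 1 with hw1
  set w₂ := (x⁻¹ * x₂).1 - 1 with hw2
  -- This combination is orthogonal to S and to 1, so the two differences lie on one line. On that
  -- line the determinant equation has a single nonzero solution.
  have h0 : w₁.trace • w₂ - w₂.trace • w₁ = 0 := by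
    refine eq_zero_of_trace_mul_eq_zero hS _ ?_
    intro b hb
    rcases hb with rfl | hb
    · simp [mul_comm]
    · have a1 : (b * w₁).trace = 0 := by
        rw [hw1, mul_sub, Matrix.trace_sub, h1 b hb, mul_one, sub_self]
      have a2 : (b * w₂).trace = 0 := by
        rw [hw2, mul_sub, Matrix.trace_sub, h2 b hb, mul_one, sub_self]
      simp [mul_sub, a1, a2]
  have h3 : w₂ = (w₂.trace / w₁.trace) • w₁ := by
    rw [div_eq_inv_mul, mul_smul, ← sub_eq_zero.1 h0, smul_smul, inv_mul_cancel₀ n1, one_smul]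
  set r := w₂.trace / w₁.trace with hr
  have hr0 : r ≠ 0 := div_ne_zero n2 n1
  have e3 : r * w₁.trace + r ^ 2 * w₁.det = 0 := by
    have : w₂.det = r ^ 2 * w₁.det := by rw [h3, Matrix.det_smul]; simp
    rw [← this, ← e2, hr]
    field_simp
  have hr1 : r = 1 := by
    have : r * ((1 - r) * w₁.trace) = 0 := by linear_combination e3 - r ^ 2 * e1
    have := ((mul_eq_zero.1 ((mul_eq_zero.1 this).resolve_left hr0)).resolve_right n1)
    exact (sub_eq_zero.1 this).symm
  rw [hr1, one_smul] at h3
  have : (x⁻¹ * x₂).1 = (x⁻¹ * x₁).1 := sub_left_injective h3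
  have h4 : x⁻¹ * x₂ = x⁻¹ * x₁ := Subtype.ext this
  exact h12 (mul_left_cancel h4).symm

end Algebra

/-! ### Escape from subspaces under conjugation -/

section Escape

variable {K : Type*} [Field K]

/-- The conjugation representation of `SL₂(K)` on `2 × 2` matrices. -/
def adRep (K : Type*) [Field K] : SL2 K →* Module.End K (M2 K) where
  toFun g := LinearMap.mulLeft K g.1 * LinearMap.mulRight K (g⁻¹).1
  map_one' := by ext1 m; simp
  map_mul' g h := by
    refine LinearMap.ext fun m => ?_
    simp only [Module.End.mul_apply, LinearMap.mulLeft_apply, LinearMap.mulRight_apply,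
      mul_inv_rev, Matrix.SpecialLinearGroup.coe_mul, mul_assoc]

theorem adRep_apply (g : SL2 K) (m : M2 K) : adRep K g m = g.1 * (m * (g⁻¹).1) := rfl

theorem adRep_coe (g x : SL2 K) : adRep K g x.1 = (g * x * g⁻¹).1 := by
  rw [adRep_apply, Matrix.SpecialLinearGroup.coe_mul, Matrix.SpecialLinearGroup.coe_mul, mul_assoc]

/-- Irreducibility of the adjoint action away from characteristic 2: a noncentral element yields one
elementary nilpotent, whose conjugates yield the rest of the traceless matrices. -/
theorem eq_top_of_conj_stable (h2 : (2 : K) ≠ 0) (W : Submodule K (M2 K)) (h1 : (1 : M2 K) ∈ W)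
    (hW : ∀ g : SL2 K, ∀ m ∈ W, adRep K g m ∈ W) {x : SL2 K}
    (hx : x ∉ Subgroup.center (SL2 K)) (hxW : x.1 ∈ W) : W = ⊤ := by
  have hconj : ∀ g y : SL2 K, y.1 ∈ W → (g * y * g⁻¹).1 ∈ W := fun g y hy => by
    rw [← adRep_coe]; exact hW g _ hy
  obtain ⟨y, hyW, hy⟩ : ∃ y : SL2 K, y.1 ∈ W ∧ y 1 0 ≠ 0 := by
    by_cases hc : x 1 0 = 0
    · by_cases hb : x 0 1 = 0
      · refine ⟨_, hconj (lower 1) x hxW, ?_⟩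
        have : x 0 0 ≠ x 1 1 := fun h => hx ((mem_center_iff_entries x).2 ⟨hb, hc, h⟩)
        simp [Matrix.vecMul, dotProduct, Fin.sum_univ_two, lower_val, Matrix.adjugate_fin_two,
          Matrix.mul_apply, hb, hc]
        exact fun e => this (by linear_combination e)
      · refine ⟨_, hconj weyl x hxW, ?_⟩
        simpa [Matrix.vecMul, dotProduct, Fin.sum_univ_two, weyl_val, Matrix.adjugate_fin_two,
          Matrix.mul_apply] using hb
    · exact ⟨x, hxW, hc⟩
  have hE : (!![0, 1; 0, 0] : M2 K) ∈ W := by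
    -- The second difference of s ↦ u(s) y u(−s) isolates its quadratic coefficient, which is −y₁₀
    -- times this matrix unit.
    have e : (!![0, 1; 0, 0] : M2 K) = (-(2 * y 1 0)⁻¹) •
        ((upper 1 * y * (upper 1)⁻¹).1 + (upper (-1) * y * (upper (-1))⁻¹).1 - (2 : K) • y.1) := by
      ext i j
      fin_cases i <;> fin_cases j <;>
        simp [Matrix.vecMul, dotProduct, Fin.sum_univ_two, Matrix.mul_apply, upper_val,
          Matrix.adjugate_fin_two] <;>
        field_simp <;> ring_nf <;> simp
    rw [e]
    exact W.smul_mem _ (W.sub_mem (W.add_mem (hconj _ _ hyW) (hconj _ _ hyW)) (W.smul_mem _ hyW))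
  have hF : (!![0, 0; 1, 0] : M2 K) ∈ W := by
    have := W.neg_mem (hW weyl _ hE)
    convert this using 1
    ext i j
    fin_cases i <;> fin_cases j <;>
      simp [adRep_apply, weyl_val, Matrix.adjugate_fin_two]
  have hH : (!![1, 0; 0, -1] : M2 K) ∈ W := by
    have := W.add_mem (W.sub_mem hE (hW (lower 1) _ hE)) (W.neg_mem hF)
    convert this using 1
    ext i j
    fin_cases i <;> fin_cases j <;>
      simp [adRep_apply, lower_val, Matrix.adjugate_fin_two]
  rw [eq_top_iff]
  intro m _
  have e : m = ((m 0 0 + m 1 1) / 2) • (1 : M2 K) + ((m 0 0 - m 1 1) / 2) • !![1, 0; 0, -1] +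
      m 0 1 • !![0, 1; 0, 0] + m 1 0 • !![0, 0; 1, 0] := by
    ext i j
    fin_cases i <;> fin_cases j <;> simp <;> field_simp <;> ring
  rw [e]
  exact W.add_mem (W.add_mem (W.add_mem (W.smul_mem _ h1) (W.smul_mem _ hH)) (W.smul_mem _ hE))
    (W.smul_mem _ hF)

/-- Evaluation at `x` carries spans of operators to spans of conjugates, so one set `F`, chosen
independently of `x`, serves every noncentral `x`. -/
theorem span_conj_eq_top (h2 : (2 : K) ≠ 0) {F : Set (SL2 K)}
    (hF : Submodule.span K (adRep K '' F) = Submodule.span K (Set.range (adRep K)))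
    {x : SL2 K} (hx : x ∉ Subgroup.center (SL2 K)) :
    Submodule.span K (insert (1 : M2 K) ((fun g : SL2 K => (g * x * g⁻¹).1) '' F)) = ⊤ := by
  have key : ∀ T : Set (Module.End K (M2 K)), Submodule.map (LinearMap.applyₗ x.1)
      (Submodule.span K T) = Submodule.span K ((fun f => f x.1) '' T) := fun T => by
    rw [Submodule.map_span]; rfl
  have h3 : Submodule.span K ((fun g : SL2 K => (g * x * g⁻¹).1) '' F) =
      Submodule.span K (Set.range fun g : SL2 K => (g * x * g⁻¹).1) := by
    have := key (adRep K '' F)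
    rw [hF, key, Set.image_image, ← Set.range_comp] at this
    simp only [adRep_coe] at this
    rw [← this]
    congr 1
    ext m
    simp [adRep_coe]
  rw [Submodule.span_insert, h3, ← Submodule.span_insert]
  refine eq_top_of_conj_stable h2 _ (Submodule.subset_span (Set.mem_insert _ _)) ?_ hx
    (Submodule.subset_span (Set.mem_insert_of_mem _ ⟨1, by simp⟩))
  intro g m hm
  induction hm using Submodule.span_induction with
  | mem y hy =>
    rcases hy with rfl | ⟨k, rfl⟩
    · have : adRep K g 1 = 1 := by
        rw [adRep_apply, one_mul, ← Matrix.SpecialLinearGroup.coe_mul, mul_inv_cancel,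
          Matrix.SpecialLinearGroup.coe_one]
      rw [this]
      exact Submodule.subset_span (Set.mem_insert _ _)
    · refine Submodule.subset_span (Set.mem_insert_of_mem _ ⟨g * k, ?_⟩)
      rw [adRep_coe]
      simp [mul_assoc]
  | zero => rw [map_zero]; exact Submodule.zero_mem _
  | add y z _ _ hy hz => rw [map_add]; exact Submodule.add_mem _ hy hz
  | smul a y _ hy => rw [map_smul]; exact Submodule.smul_mem _ _ hy

/-- A generating set contains, within sixteen steps, a bounded set of conjugators in general
position. -/
theorem exists_conjugators [DecidableEq K] (h2 : (2 : K) ≠ 0) {A : Finset (SL2 K)}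
    (h1 : (1 : SL2 K) ∈ A) (hinv : A⁻¹ = A)
    (hgen : Subgroup.closure (A : Set (SL2 K)) = ⊤) :
    ∃ F : Finset (SL2 K), F ⊆ A ^ 16 ∧ F.card ≤ 16 ∧ ∀ x ∉ Subgroup.center (SL2 K),
      Submodule.span K (insert (1 : M2 K) ((fun g : SL2 K => (g * x * g⁻¹).1) '' F)) = ⊤ := by
  have hd : Module.finrank K (Module.End K (M2 K)) = 16 := by
    rw [Module.finrank_linearMap, Module.finrank_matrix]; simp
  obtain ⟨F, hFA, hFc, hF⟩ := exists_finset_span_image_eq (adRep K) h1 hinv hgen hd.le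
  exact ⟨F, hFA, hFc.trans hd.le, fun x hx => span_conj_eq_top h2 hF hx⟩

theorem exists_conj_notMem {F : Finset (SL2 K)}
    (hF : ∀ x ∉ Subgroup.center (SL2 K),
      Submodule.span K (insert (1 : M2 K) ((fun g : SL2 K => (g * x * g⁻¹).1) '' F)) = ⊤)
    {x : SL2 K} (hx : x ∉ Subgroup.center (SL2 K)) {W : Submodule K (M2 K)} (h1 : 1 ∈ W)
    (hW : W ≠ ⊤) : ∃ g ∈ F, (g * x * g⁻¹).1 ∉ W := by
  by_contra! h
  refine hW (eq_top_iff.2 ?_)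
  rw [← hF x hx, Submodule.span_le]
  rintro _ (rfl | ⟨g, hg, rfl⟩)
  · exact h1
  · exact h g hg

theorem notMem_span_one {x : SL2 K} (hx : x ∉ Subgroup.center (SL2 K)) :
    x.1 ∉ Submodule.span K ({1} : Set (M2 K)) := by
  intro h
  obtain ⟨a, ha⟩ := Submodule.mem_span_singleton.1 h
  refine hx ((mem_center_iff_entries x).2 ?_)
  rw [← ha]
  simp

/-- The basis is built one vector at a time: while the span is proper it misses some `F`-conjugate
of the next element. -/
theorem exists_conj_span_eq_top {F : Finset (SL2 K)}
    (hF : ∀ x ∉ Subgroup.center (SL2 K),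
      Submodule.span K (insert (1 : M2 K) ((fun g : SL2 K => (g * x * g⁻¹).1) '' F)) = ⊤)
    {x y z : SL2 K} (hx : x ∉ Subgroup.center (SL2 K)) (hy : y ∉ Subgroup.center (SL2 K))
    (hz : z ∉ Subgroup.center (SL2 K)) :
    ∃ g ∈ F, ∃ h ∈ F, Submodule.span K
      ({1, x.1, (g * y * g⁻¹).1, (h * z * h⁻¹).1} : Set (M2 K)) = ⊤ := by
  classical
  have hd : Module.finrank K (M2 K) = 4 := by rw [Module.finrank_matrix]; simp
  have hlt : ∀ (S : Set (M2 K)) (v : M2 K), v ∉ Submodule.span K S →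
      Module.finrank K (Submodule.span K S) + 1 ≤
        Module.finrank K (Submodule.span K (insert v S)) := by
    intro S v hv
    refine Submodule.finrank_lt_finrank_of_lt (lt_of_le_of_ne
      (Submodule.span_mono (Set.subset_insert _ _)) fun e => hv ?_)
    rw [e]
    exact Submodule.subset_span (Set.mem_insert _ _)
  have hne : ∀ S : Finset (M2 K), S.card < 4 → Submodule.span K (S : Set (M2 K)) ≠ ⊤ := by
    intro S hS e
    have h1 := finrank_span_finset_le_card (R := K) S
    rw [Set.finrank, e, finrank_top, hd] at h1
    omega
  have r1 : 1 ≤ Module.finrank K (Submodule.span K ({1} : Set (M2 K))) := by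
    rw [finrank_span_singleton one_ne_zero]
  have r2 := hlt _ _ (notMem_span_one hx)
  obtain ⟨g, hg, hgW⟩ := exists_conj_notMem hF hy (W := Submodule.span K {x.1, 1})
    (Submodule.subset_span (by simp))
    (by have := hne {x.1, 1} (lt_of_le_of_lt Finset.card_le_two (by norm_num)); simpa using this)
  have r3 := hlt _ _ hgW
  obtain ⟨h, hh, hhW⟩ := exists_conj_notMem hF hz
    (W := Submodule.span K {(g * y * g⁻¹).1, x.1, 1})
    (Submodule.subset_span (by simp))
    (by
      have := hne {(g * y * g⁻¹).1, x.1, 1} (lt_of_le_of_lt Finset.card_le_three (by norm_num))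
      simpa only [Finset.coe_insert, Finset.coe_singleton] using this)
  have r4 := hlt _ _ hhW
  refine ⟨g, hg, h, hh, ?_⟩
  have e : ({1, x.1, (g * y * g⁻¹).1, (h * z * h⁻¹).1} : Set (M2 K)) =
      {(h * z * h⁻¹).1, (g * y * g⁻¹).1, x.1, 1} := by
    ext m; simp only [Set.mem_insert_iff, Set.mem_singleton_iff]; tauto
  rw [e]
  refine Submodule.eq_top_of_finrank_eq (le_antisymm (Submodule.finrank_le _) ?_)
  rw [hd]
  omega

/-- The identity tr(ab) + tr(ab⁻¹) = tr a · tr b = ±4 forces both terms on the left to be equal, so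
2 tr(ab) = tr a · tr b. -/
theorem commute_of_trace_sq_eq_four (h2 : (2 : K) ≠ 0) {a b : SL2 K} (ha : a.1.trace ^ 2 = 4)
    (hb : b.1.trace ^ 2 = 4) (hab : (a * b).1.trace ^ 2 = 4)
    (hab' : (a * b⁻¹).1.trace ^ 2 = 4) : a * b = b * a := by
  have pm : ∀ {t : K}, t ^ 2 = 4 → t = 2 ∨ t = -2 := fun {t} h =>
    sq_eq_sq_iff_eq_or_eq_neg.1 (by rw [h]; norm_num)
  have h4 : (4 : K) ≠ 0 := by
    have : (4 : K) = 2 * 2 := by norm_num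
    rw [this]; exact mul_ne_zero h2 h2
  have hsum : (a * b).1.trace + (a * b⁻¹).1.trace = a.1.trace * b.1.trace := by
    rw [Matrix.SpecialLinearGroup.coe_mul, Matrix.SpecialLinearGroup.coe_mul, inv_val]
    simp only [Matrix.trace_fin_two, Matrix.mul_apply, Fin.sum_univ_two]
    simp
    ring
  have hprod : 2 * (a * b).1.trace = a.1.trace * b.1.trace := by
    rcases pm hab with h | h <;> rcases pm hab' with h' | h'
    · rw [h, h'] at hsum; rw [h, ← hsum]; norm_num
    · exfalso
      have h0 : a.1.trace * b.1.trace = 0 := by rw [← hsum, h, h']; norm_num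
      have : (a.1.trace * b.1.trace) ^ 2 = 4 * 4 := by rw [mul_pow, ha, hb]
      rw [h0] at this
      exact mul_ne_zero h4 h4 (by rw [← this]; norm_num)
    · exfalso
      have h0 : a.1.trace * b.1.trace = 0 := by rw [← hsum, h, h']; norm_num
      have : (a.1.trace * b.1.trace) ^ 2 = 4 * 4 := by rw [mul_pow, ha, hb]
      rw [h0] at this
      exact mul_ne_zero h4 h4 (by rw [← this]; norm_num)
    · rw [h, h'] at hsum; rw [h, ← hsum]; norm_num
  have da := det_eq a
  have db := det_eq b
  rw [Matrix.SpecialLinearGroup.coe_mul] at hprod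
  simp only [Matrix.trace_fin_two, Matrix.mul_apply, Fin.sum_univ_two] at hprod ha hb
  set a₁ := a 0 0
  set a₂ := a 0 1
  set a₃ := a 1 0
  set a₄ := a 1 1
  set b₁ := b 0 0
  set b₂ := b 0 1
  set b₃ := b 1 0
  set b₄ := b 1 1
  -- the traceless parts are nilpotent and orthogonal, hence proportional
  have na : (a₁ - a₄) ^ 2 + 4 * (a₂ * a₃) = 0 := by linear_combination ha - 4 * da
  have nb : (b₁ - b₄) ^ 2 + 4 * (b₂ * b₃) = 0 := by linear_combination hb - 4 * db
  have nab : (a₁ - a₄) * (b₁ - b₄) + 2 * (a₂ * b₃ + a₃ * b₂) = 0 := by linear_combination hprod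
  have k1 : a₂ * b₃ = b₂ * a₃ := by
    have : 4 * (a₂ * b₃ - b₂ * a₃) ^ 2 = 0 := by
      linear_combination (2 * (a₂ * b₃ + a₃ * b₂) - (a₁ - a₄) * (b₁ - b₄)) * nab -
        4 * a₂ * a₃ * nb + (b₁ - b₄) ^ 2 * na
    exact sub_eq_zero.1 (pow_eq_zero_iff (n := 2) (by norm_num) |>.1
      ((mul_eq_zero.1 this).resolve_left h4))
  have k2 : (a₁ - a₄) * b₂ = (b₁ - b₄) * a₂ := by
    have : ((a₁ - a₄) * b₂ - (b₁ - b₄) * a₂) ^ 2 = 0 := by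
      linear_combination b₂ ^ 2 * na + a₂ ^ 2 * nb - 2 * a₂ * b₂ * nab
    exact sub_eq_zero.1 (pow_eq_zero_iff (n := 2) (by norm_num) |>.1 this)
  have k3 : (a₁ - a₄) * b₃ = (b₁ - b₄) * a₃ := by
    have : ((a₁ - a₄) * b₃ - (b₁ - b₄) * a₃) ^ 2 = 0 := by
      linear_combination b₃ ^ 2 * na + a₃ ^ 2 * nb - 2 * a₃ * b₃ * nab
    exact sub_eq_zero.1 (pow_eq_zero_iff (n := 2) (by norm_num) |>.1 this)
  rw [commute_iff]
  exact ⟨k1, by linear_combination k2, by linear_combination -k3⟩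

/-- A generating set contains a regular semisimple element within two steps. -/
theorem exists_trace_sq_ne_four [DecidableEq K] (h2 : (2 : K) ≠ 0) {A : Finset (SL2 K)}
    (h1 : (1 : SL2 K) ∈ A) (hinv : A⁻¹ = A)
    (hgen : Subgroup.closure (A : Set (SL2 K)) = ⊤) : ∃ g ∈ A ^ 2, g.1.trace ^ 2 ≠ 4 := by
  -- Otherwise the generators commute pairwise, making the group abelian.
  by_contra! h
  have hA : ∀ a ∈ A, a ∈ A ^ 2 := fun a ha => by
    rw [pow_two]; simpa using Finset.mul_mem_mul ha h1
  have hcomm : ∀ a ∈ A, ∀ b ∈ A, a * b = b * a := by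
    intro a ha b hb
    have hb' : b⁻¹ ∈ A := by rw [← hinv]; exact Finset.inv_mem_inv hb
    refine commute_of_trace_sq_eq_four h2 (h a (hA a ha)) (h b (hA b hb)) (h _ ?_) (h _ ?_)
    · rw [pow_two]; exact Finset.mul_mem_mul ha hb
    · rw [pow_two]; exact Finset.mul_mem_mul ha hb'
  have hcen : ∀ b ∈ A, Subgroup.closure (A : Set (SL2 K)) ≤ Subgroup.centralizer {b} := by
    intro b hb
    rw [Subgroup.closure_le]
    intro a ha
    rw [SetLike.mem_coe, Subgroup.mem_centralizer_singleton_iff]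
    exact hcomm a ha b hb
  have hcen2 : Subgroup.closure (A : Set (SL2 K)) ≤ Subgroup.center (SL2 K) := by
    rw [Subgroup.closure_le]
    intro b hb
    rw [SetLike.mem_coe, Subgroup.mem_center_iff]
    intro g
    have := hcen b hb (hgen ▸ Subgroup.mem_top g)
    rw [Subgroup.mem_centralizer_singleton_iff] at this
    exact this
  rw [hgen] at hcen2
  have := (mem_center_iff_entries (upper (1 : K))).1 (hcen2 (Subgroup.mem_top _))
  simp [upper] at this

theorem notMem_center_of_trace_sq_ne_four {g : SL2 K} (hg : g.1.trace ^ 2 ≠ 4) :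
    g ∉ Subgroup.center (SL2 K) := by
  intro h
  obtain ⟨h1, h2, h3⟩ := (mem_center_iff_entries g).1 h
  have := det_eq g
  rw [h1, ← h3] at this
  refine hg ?_
  rw [Matrix.trace_fin_two, ← h3]
  linear_combination 4 * this

end Escape

/-! ### Larsen–Pink estimate, pivoting and growth -/

section Growth

variable {K : Type*} [Field K] [DecidableEq K]

theorem notMem_center_conj {G : Type*} [Group G] {x : G} (hx : x ∉ Subgroup.center G) (g : G) :
    g * x * g⁻¹ ∉ Subgroup.center G := fun h => hx (by
  have := Subgroup.Normal.conj_mem (inferInstance : (Subgroup.center G).Normal) _ h g⁻¹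
  simpa [mul_assoc] using this)

/-- Larsen–Pink type estimate: a set of noncentral elements of constant trace has size at most
about the `2/3` power of the size of its product sets. -/
theorem card_pow_three_le_of_trace_eq (h2 : (2 : K) ≠ 0) {A : Finset (SL2 K)}
    (h1 : (1 : SL2 K) ∈ A) (hinv : A⁻¹ = A)
    (hgen : Subgroup.closure (A : Set (SL2 K)) = ⊤) {X : Finset (SL2 K)} (hXA : X ⊆ A ^ 4)
    (hXc : ∀ x ∈ X, x ∉ Subgroup.center (SL2 K)) {t : K} (hXt : ∀ x ∈ X, x.1.trace = t) :
    X.card ^ 3 ≤ 512 * (A ^ 24).card ^ 2 := by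
  obtain ⟨F, hFA, hFc, hF⟩ := exists_conjugators h2 h1 hinv hgen
  have hex : ∀ τ : SL2 K × SL2 K × SL2 K, ∃ gh : SL2 K × SL2 K, τ ∈ X ×ˢ X ×ˢ X →
      gh.1 ∈ F ∧ gh.2 ∈ F ∧ Submodule.span K ({1, τ.1.1, (gh.1 * τ.2.1⁻¹ * gh.1⁻¹).1,
        (gh.2 * τ.2.2⁻¹ * gh.2⁻¹).1} : Set (M2 K)) = ⊤ := by
    rintro ⟨x, y, z⟩
    by_cases hτ : (x, y, z) ∈ X ×ˢ X ×ˢ X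
    · simp only [Finset.mem_product] at hτ
      obtain ⟨g, hg, h, hh, hs⟩ := exists_conj_span_eq_top hF (hXc x hτ.1)
        (mt inv_mem_iff.1 (hXc y hτ.2.1)) (mt inv_mem_iff.1 (hXc z hτ.2.2))
      exact ⟨(g, h), fun _ => ⟨hg, hh, hs⟩⟩
    · exact ⟨(1, 1), fun h => absurd h hτ⟩
  choose σ hσ using hex
  -- The conjugators depend on the triple, so they are recorded in the value: on a fibre they are
  -- constant, and the first coordinate determines the other two.
  let φ : SL2 K × SL2 K × SL2 K → (SL2 K × SL2 K) × (SL2 K × SL2 K) := fun τ =>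
    (σ τ, (τ.1 * (σ τ).1 * τ.2.1, τ.1 * (σ τ).2 * τ.2.2))
  have hmem : ∀ x ∈ X, ∀ g ∈ F, ∀ y ∈ X, x * g * y ∈ A ^ 24 := by
    intro x hx g hg y hy
    have : A ^ 24 = A ^ 4 * A ^ 16 * A ^ 4 := by rw [← pow_add, ← pow_add]
    rw [this]
    exact Finset.mul_mem_mul (Finset.mul_mem_mul (hXA hx) (hFA hg)) (hXA hy)
  have hmaps : ∀ τ ∈ X ×ˢ X ×ˢ X, φ τ ∈ (F ×ˢ F) ×ˢ ((A ^ 24) ×ˢ (A ^ 24)) := by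
    intro τ hτ
    obtain ⟨hg, hh, -⟩ := hσ τ hτ
    simp only [Finset.mem_product] at hτ
    simp only [φ, Finset.mem_product]
    exact ⟨⟨hg, hh⟩, hmem _ hτ.1 _ hg _ hτ.2.1, hmem _ hτ.1 _ hh _ hτ.2.2⟩
  have hfib : ∀ b ∈ (F ×ˢ F) ×ˢ ((A ^ 24) ×ˢ (A ^ 24)),
      ((X ×ˢ X ×ˢ X).filter fun τ => φ τ = b).card ≤ 2 := by
    rintro ⟨⟨g, h⟩, y, z⟩ -
    by_contra! hcard
    obtain ⟨τ, hτ, τ₁, hτ₁, τ₂, hτ₂, e1, e2, e12⟩ := Finset.two_lt_card.1 hcard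
    have key : ∀ τ ∈ (X ×ˢ X ×ˢ X).filter fun τ => φ τ = ((g, h), y, z),
        (τ.1 ∈ X ∧ τ.2.1 ∈ X ∧ τ.2.2 ∈ X) ∧ σ τ = (g, h) ∧ τ.1 * g * τ.2.1 = y ∧
          τ.1 * h * τ.2.2 = z := by
      intro τ hτ
      obtain ⟨hτX, hφ⟩ := Finset.mem_filter.1 hτ
      simp only [φ, Prod.mk.injEq] at hφ
      obtain ⟨e, e', e''⟩ := hφ
      rw [e] at e' e''
      simp only [Finset.mem_product] at hτX
      exact ⟨hτX, e, e', e''⟩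
    have hinj : ∀ τ ∈ (X ×ˢ X ×ˢ X).filter fun τ => φ τ = ((g, h), y, z),
        ∀ τ' ∈ (X ×ˢ X ×ˢ X).filter fun τ => φ τ = ((g, h), y, z), τ.1 = τ'.1 → τ = τ' := by
      intro τ hτ τ' hτ' e
      obtain ⟨-, -, p, r⟩ := key τ hτ
      obtain ⟨-, -, p', r'⟩ := key τ' hτ'
      refine Prod.ext e (Prod.ext ?_ ?_)
      · rw [e, ← p'] at p; exact mul_left_cancel p
      · rw [e, ← r'] at r; exact mul_left_cancel r
    obtain ⟨hX, hs, hy, hz⟩ := key τ hτ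
    have hspan := (hσ τ (Finset.mem_filter.1 hτ).1).2.2
    rw [hs] at hspan
    -- Right multiplication by x⁻¹x' carries x to x', and g y⁻¹ g⁻¹ to g y'⁻¹ g⁻¹ when xgy = x'gy'.
    -- All these traces equal t, so at most two values of x' occur on a fibre.
    have htr : ∀ τ' ∈ (X ×ˢ X ×ˢ X).filter fun τ => φ τ = ((g, h), y, z),
        ∀ b ∈ ({τ.1.1, (g * τ.2.1⁻¹ * g⁻¹).1, (h * τ.2.2⁻¹ * h⁻¹).1} : Set (M2 K)),
        (b * (τ.1⁻¹ * τ'.1).1).trace = b.trace := by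
      intro τ' hτ' b hb
      obtain ⟨hX', -, hy', hz'⟩ := key τ' hτ'
      have conj : ∀ (g y₀ y₁ : SL2 K), y₀ ∈ X → y₁ ∈ X → τ.1 * g * y₀ = τ'.1 * g * y₁ →
          ((g * y₀⁻¹ * g⁻¹).1 * (τ.1⁻¹ * τ'.1).1).trace = (g * y₀⁻¹ * g⁻¹).1.trace := by
        intro g y₀ y₁ m₀ m₁ e
        have : g * y₀⁻¹ * g⁻¹ * (τ.1⁻¹ * τ'.1) = g * y₁⁻¹ * g⁻¹ := by
          have e' : τ'.1 = τ.1 * g * y₀ * y₁⁻¹ * g⁻¹ := by rw [e]; group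
          rw [e']; group
        rw [← Matrix.SpecialLinearGroup.coe_mul, this, trace_conj, trace_conj, trace_inv,
          trace_inv, hXt _ m₀, hXt _ m₁]
      rcases hb with rfl | rfl | rfl
      · rw [← Matrix.SpecialLinearGroup.coe_mul, mul_inv_cancel_left, hXt _ hX.1, hXt _ hX'.1]
      · exact conj g _ _ hX.2.1 hX'.2.1 (hy.trans hy'.symm)
      · exact conj h _ _ hX.2.2 hX'.2.2 (hz.trans hz'.symm)
    rcases eq_or_eq_or_eq_of_trace_eq hspan (htr τ₁ hτ₁) (htr τ₂ hτ₂) with e | e | e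
    · exact e1 (hinj _ hτ _ hτ₁ e)
    · exact e2 (hinj _ hτ _ hτ₂ e)
    · exact e12 (hinj _ hτ₁ _ hτ₂ e)
  have hle := Finset.card_le_mul_card_image_of_maps_to hmaps 2 hfib
  simp only [Finset.card_product] at hle
  have hFF : F.card * F.card ≤ 16 * 16 := Nat.mul_le_mul hFc hFc
  calc X.card ^ 3 = X.card * (X.card * X.card) := by ring
    _ ≤ 2 * (F.card * F.card * ((A ^ 24).card * (A ^ 24).card)) := hle
    _ ≤ 2 * (16 * 16 * ((A ^ 24).card * (A ^ 24).card)) := by gcongr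
    _ = _ := by ring

/-- Orbit-stabilizer for sets: the centralizer of a noncentral `g ∈ A²` meets `A²` in at least
about `|A|^{1/3}` elements. -/
theorem card_pow_three_le_centralizer (h2 : (2 : K) ≠ 0) {A : Finset (SL2 K)}
    (h1 : (1 : SL2 K) ∈ A) (hinv : A⁻¹ = A)
    (hgen : Subgroup.closure (A : Set (SL2 K)) = ⊤) {g : SL2 K} (hg : g ∈ A ^ 2)
    (hgc : g ∉ Subgroup.center (SL2 K)) :
    A.card ^ 3 ≤ 512 * ((A ^ 2).filter fun y => y * g = g * y).card ^ 3 * (A ^ 24).card ^ 2 := by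
  set X := A.image fun a => a * g * a⁻¹ with hX
  have hinvm : ∀ a ∈ A, a⁻¹ ∈ A := fun a ha => by rw [← hinv]; exact Finset.inv_mem_inv ha
  have hXle : X.card ^ 3 ≤ 512 * (A ^ 24).card ^ 2 := by
    refine card_pow_three_le_of_trace_eq h2 h1 hinv hgen (X := X) (t := g.1.trace) ?_ ?_ ?_
    · intro x hx
      obtain ⟨a, ha, rfl⟩ := Finset.mem_image.1 hx
      have : A ^ 4 = A * A ^ 2 * A := by rw [← pow_succ', ← pow_succ]
      rw [this]
      exact Finset.mul_mem_mul (Finset.mul_mem_mul ha hg) (hinvm a ha)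
    · intro x hx
      obtain ⟨a, ha, rfl⟩ := Finset.mem_image.1 hx
      exact notMem_center_conj hgc a
    · intro x hx
      obtain ⟨a, ha, rfl⟩ := Finset.mem_image.1 hx
      exact trace_conj a g
  -- Two elements with the same conjugate of g differ by an element of its centralizer.
  have hA : A.card ≤ ((A ^ 2).filter fun y => y * g = g * y).card * X.card := by
    refine Finset.card_le_mul_card_image A _ fun b hb => ?_
    obtain ⟨a₀, ha₀, rfl⟩ := Finset.mem_image.1 hb
    refine Finset.card_le_card_of_injOn (fun a => a₀⁻¹ * a) ?_ fun a _ b _ h => mul_left_cancel h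
    intro a ha
    obtain ⟨ha, he⟩ := Finset.mem_filter.1 ha
    refine Finset.mem_filter.2 ⟨?_, ?_⟩
    · rw [pow_two]; exact Finset.mul_mem_mul (hinvm a₀ ha₀) ha
    · have : a * g = a₀ * g * a₀⁻¹ * a := by rw [← he]; group
      rw [mul_assoc, this]; group
  calc A.card ^ 3 ≤ (((A ^ 2).filter fun y => y * g = g * y).card * X.card) ^ 3 := by gcongr
    _ = ((A ^ 2).filter fun y => y * g = g * y).card ^ 3 * X.card ^ 3 := by ring
    _ ≤ ((A ^ 2).filter fun y => y * g = g * y).card ^ 3 * (512 * (A ^ 24).card ^ 2) := by gcongr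
    _ = _ := by ring

/-- If the centralizer of `a g a⁻¹` meets `A²` only in the center, then `A⁵` is large. -/
theorem card_mul_card_centralizer_le {A : Finset (SL2 K)} (hinv : A⁻¹ = A) {g a : SL2 K}
    (ha : a ∈ A) (htriv : ∀ y ∈ A ^ 2, y * (a * g * a⁻¹) = a * g * a⁻¹ * y →
      y ∈ Subgroup.center (SL2 K)) :
    A.card * ((A ^ 2).filter fun y => y * g = g * y).card ≤ 2 * (A ^ 5).card := by
  have hinvm : ∀ a ∈ A, a⁻¹ ∈ A := fun a ha => by rw [← hinv]; exact Finset.inv_mem_inv ha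
  rw [← Finset.card_product]
  -- Within a fibre, b₀⁻¹b = a s₀ s⁻¹ a⁻¹ lies in A² and commutes with a g a⁻¹, so it is central;
  -- and b determines s.
  refine Finset.card_le_mul_card_image_of_maps_to
    (f := fun bs : SL2 K × SL2 K => bs.1 * (a * bs.2 * a⁻¹)) ?_ 2 ?_
  · rintro ⟨b, s⟩ hbs
    obtain ⟨hb, hs⟩ := Finset.mem_product.1 hbs
    have : A ^ 5 = A * (A * A ^ 2 * A) := by rw [← pow_succ', ← pow_succ, ← pow_succ']
    rw [this]
    exact Finset.mul_mem_mul hb (Finset.mul_mem_mul (Finset.mul_mem_mul ha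
      (Finset.mem_filter.1 hs).1) (hinvm a ha))
  · intro v _
    set T := (A ×ˢ (A ^ 2).filter fun y => y * g = g * y).filter
      fun bs : SL2 K × SL2 K => bs.1 * (a * bs.2 * a⁻¹) = v with hT
    have hmem : ∀ bs ∈ T, bs.1 ∈ A ∧ bs.2 * g = g * bs.2 ∧ bs.1 * (a * bs.2 * a⁻¹) = v := by
      intro bs hbs
      obtain ⟨h, hv⟩ := Finset.mem_filter.1 hbs
      obtain ⟨hb, hs⟩ := Finset.mem_product.1 h
      exact ⟨hb, (Finset.mem_filter.1 hs).2, hv⟩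
    rcases T.eq_empty_or_nonempty with h0 | ⟨⟨b₀, s₀⟩, h0⟩
    · simp [h0]
    · obtain ⟨hb₀, hs₀, hv₀⟩ := hmem _ h0
      have hinj : Set.InjOn (fun bs : SL2 K × SL2 K => b₀⁻¹ * bs.1) T := by
        rintro ⟨b, s⟩ h ⟨b', s'⟩ h' e
        obtain ⟨-, -, hv⟩ := hmem _ h
        obtain ⟨-, -, hv'⟩ := hmem _ h'
        have e1 : b = b' := mul_left_cancel e
        subst e1
        rw [← hv'] at hv
        exact Prod.ext rfl (mul_left_cancel (mul_right_cancel (mul_left_cancel hv)))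
      rw [← Finset.card_image_of_injOn hinj]
      refine center_card_le_two _ fun y hy => ?_
      obtain ⟨⟨b, s⟩, hbs, rfl⟩ := Finset.mem_image.1 hy
      obtain ⟨hb, hs, hv⟩ := hmem _ hbs
      simp only at hs hv hs₀ hv₀ hb hb₀ ⊢
      refine htriv _ (by rw [pow_two]; exact Finset.mul_mem_mul (hinvm _ hb₀) hb) ?_
      have e : b₀⁻¹ * b = a * (s₀ * s⁻¹) * a⁻¹ := by
        have e' : b = b₀ * (a * s₀ * a⁻¹) * (a * s * a⁻¹)⁻¹ := by rw [hv₀, ← hv]; group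
        rw [e']; group
      have hc : s₀ * s⁻¹ * g = g * (s₀ * s⁻¹) := by
        have hs' : s⁻¹ * g = g * s⁻¹ := by rw [inv_mul_eq_iff_eq_mul, ← mul_assoc, hs]; group
        rw [mul_assoc, hs', ← mul_assoc, hs₀, mul_assoc]
      rw [e]
      calc a * (s₀ * s⁻¹) * a⁻¹ * (a * g * a⁻¹) = a * (s₀ * s⁻¹ * g) * a⁻¹ := by group
        _ = a * (g * (s₀ * s⁻¹)) * a⁻¹ := by rw [hc]
        _ = _ := by group

variable [Fintype K]

/-- Number of conjugates of the centralizer of a regular semisimple element containing a given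
noncentral element. -/
theorem card_conj_commute_le (h2 : (2 : K) ≠ 0) {g y : SL2 K} (hg : g.1.trace ^ 2 ≠ 4)
    (hy : y ∉ Subgroup.center (SL2 K)) :
    ((Finset.univ : Finset (SL2 K)).filter fun x => y * (x * g * x⁻¹) = x * g * x⁻¹ * y).card ≤
      4 * Fintype.card K := by
  set T := (Finset.univ : Finset (SL2 K)).filter fun x => y * (x * g * x⁻¹) = x * g * x⁻¹ * y
    with hT
  -- The fibres of x ↦ x⁻¹yx lie in cosets of the centralizer of y. Its values on T commute with g
  -- and have the trace of y, so there are at most two.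
  have hle : T.card ≤ 2 * Fintype.card K * (T.image fun x => x⁻¹ * y * x).card := by
    refine Finset.card_le_mul_card_image T _ fun b hb => ?_
    obtain ⟨x₀, hx₀, rfl⟩ := Finset.mem_image.1 hb
    have hinj : Set.InjOn (fun x => x * x₀⁻¹)
        (T.filter fun x => x⁻¹ * y * x = x₀⁻¹ * y * x₀ : Finset (SL2 K)) :=
      fun a _ b _ h => mul_right_cancel h
    rw [← Finset.card_image_of_injOn hinj]
    refine card_centralizer_le hy _ fun z hz => ?_
    obtain ⟨x, hx, rfl⟩ := Finset.mem_image.1 hz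
    have e := (Finset.mem_filter.1 hx).2
    have e' : x * (x₀⁻¹ * y * x₀) = y * x := by rw [← e]; group
    calc x * x₀⁻¹ * y = x * (x₀⁻¹ * y * x₀) * x₀⁻¹ := by group
      _ = _ := by rw [e']; group
  have himg : (T.image fun x => x⁻¹ * y * x).card ≤ 2 := by
    refine card_trace_eq_le h2 hg (notMem_center_of_trace_sq_ne_four hg) y.1.trace _ ?_
    intro z hz
    obtain ⟨x, hx, rfl⟩ := Finset.mem_image.1 hz
    have e := (Finset.mem_filter.1 hx).2
    constructor
    · calc x⁻¹ * y * x * g = x⁻¹ * (y * (x * g * x⁻¹)) * x := by group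
        _ = _ := by rw [e]; group
    · have := trace_conj x⁻¹ y
      rwa [inv_inv] at this
  calc T.card ≤ 2 * Fintype.card K * (T.image fun x => x⁻¹ * y * x).card := hle
    _ ≤ 2 * Fintype.card K * 2 := by gcongr
    _ = _ := by ring

theorem card_SL2_ge : Fintype.card K ^ 2 * (Fintype.card K - 1) ≤ Fintype.card (SL2 K) := by
  have h : Fintype.card (K × K × Kˣ) ≤ Fintype.card (SL2 K) := by
    refine Fintype.card_le_of_injective
      (fun p : K × K × Kˣ => (⟨!![(p.2.2 : K), p.1; p.2.1, (1 + p.1 * p.2.1) / p.2.2], by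
        rw [Matrix.det_fin_two_of]; field_simp; ring⟩ : SL2 K)) ?_
    rintro ⟨b, c, a⟩ ⟨b', c', a'⟩ h
    have e00 : (a : K) = a' := congrArg (fun x : SL2 K => x.1 0 0) h
    have e01 : b = b' := congrArg (fun x : SL2 K => x.1 0 1) h
    have e10 : c = c' := congrArg (fun x : SL2 K => x.1 1 0) h
    rw [e01, e10, Units.ext e00]
  rw [Fintype.card_prod, Fintype.card_prod, Fintype.card_units] at h
  calc _ = _ := by ring
    _ ≤ _ := h

/-- If all conjugates of the centralizer of a regular semisimple element meet `A²` outside the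
center, then `A` grows relative to the size of the field. -/
theorem pow_six_mul_card_pow_three_le (h2 : (2 : K) ≠ 0) {A : Finset (SL2 K)}
    (h1 : (1 : SL2 K) ∈ A) (hinv : A⁻¹ = A)
    (hgen : Subgroup.closure (A : Set (SL2 K)) = ⊤) {g : SL2 K} (hg : g.1.trace ^ 2 ≠ 4)
    (hall : ∀ x : SL2 K, ∃ y ∈ A ^ 2, y ∉ Subgroup.center (SL2 K) ∧
      y * (x * g * x⁻¹) = x * g * x⁻¹ * y) :
    Fintype.card K ^ 6 * A.card ^ 3 ≤ 7077888 * (A ^ 24).card ^ 5 := by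
  classical
  have hgc := notMem_center_of_trace_sq_ne_four hg
  set q := Fintype.card K with hq
  set B := (A ^ 2).filter fun y => y ∉ Subgroup.center (SL2 K) with hB
  let N : SL2 K → ℕ := fun x => (B.filter fun y => y * (x * g * x⁻¹) = x * g * x⁻¹ * y).card
  have hN : ∀ x, A.card ^ 3 ≤ 512 * (3 * N x) ^ 3 * (A ^ 24).card ^ 2 := by
    intro x
    obtain ⟨y, hy, hyc, hcomm⟩ := hall x
    have hxg := notMem_center_conj hgc x
    have h3 := card_pow_three_le_centralizer h2 h1 hinv hgen hy hyc
    -- The count is at most N + 2, the 2 being for the center, and N ≥ 1.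
    have h4 : ((A ^ 2).filter fun z => z * y = y * z).card ≤ 3 * N x := by
      have hsub : ((A ^ 2).filter fun z => z * y = y * z) ⊆
          (B.filter fun z => z * (x * g * x⁻¹) = x * g * x⁻¹ * z) ∪
            (A ^ 2).filter fun z => z ∈ Subgroup.center (SL2 K) := by
        intro z hz
        obtain ⟨hz, hzy⟩ := Finset.mem_filter.1 hz
        by_cases hzc : z ∈ Subgroup.center (SL2 K)
        · exact Finset.mem_union_right _ (Finset.mem_filter.2 ⟨hz, hzc⟩)
        · refine Finset.mem_union_left _ (Finset.mem_filter.2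
            ⟨Finset.mem_filter.2 ⟨hz, hzc⟩, commute_trans hyc hzy hcomm.symm⟩)
      have h5 := (Finset.card_le_card hsub).trans (Finset.card_union_le _ _)
      have h6 := center_card_le_two ((A ^ 2).filter fun z => z ∈ Subgroup.center (SL2 K))
        fun z hz => (Finset.mem_filter.1 hz).2
      have h7 : 0 < N x := Finset.card_pos.2 ⟨y, Finset.mem_filter.2
        ⟨Finset.mem_filter.2 ⟨hy, hyc⟩, hcomm⟩⟩
      have h8 : N x = (B.filter fun z => z * (x * g * x⁻¹) = x * g * x⁻¹ * z).card := rfl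
      omega
    calc _ ≤ _ := h3
      _ ≤ _ := by gcongr
  -- Double counting of pairs (x, y); the minimiser of N chosen next is at most the mean.
  have hsum : ∑ x, N x ≤ B.card * (4 * q) := by
    have : ∑ x, N x = ∑ y ∈ B, ((Finset.univ : Finset (SL2 K)).filter
        fun x => y * (x * g * x⁻¹) = x * g * x⁻¹ * y).card := by
      simp only [N, Finset.card_filter]
      exact Finset.sum_comm
    rw [this, ← smul_eq_mul, ← Finset.sum_const]
    exact Finset.sum_le_sum fun y hy => card_conj_commute_le h2 hg (Finset.mem_filter.1 hy).2
  obtain ⟨x, -, hx⟩ := Finset.exists_min_image Finset.univ N ⟨1, Finset.mem_univ _⟩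
  have h3 : Fintype.card (SL2 K) * N x ≤ (A ^ 24).card * (4 * q) := by
    calc Fintype.card (SL2 K) * N x = ∑ _z : SL2 K, N x := by simp
      _ ≤ ∑ z, N z := Finset.sum_le_sum fun z hz => hx z hz
      _ ≤ B.card * (4 * q) := hsum
      _ ≤ (A ^ 24).card * (4 * q) := by
        gcongr
        exact (Finset.filter_subset _ _).trans (Finset.pow_subset_pow_right h1 (by norm_num))
  have hq2 : 2 ≤ q := Fintype.one_lt_card
  have h4 : q ^ 3 ≤ 2 * Fintype.card (SL2 K) := by
    refine le_trans ?_ (Nat.mul_le_mul_left 2 card_SL2_ge)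
    rw [← hq]
    obtain ⟨r, hr⟩ : ∃ r, q = r + 2 := ⟨q - 2, by omega⟩
    rw [hr]
    simp only [Nat.add_succ_sub_one]
    nlinarith [Nat.zero_le r, sq_nonneg r]
  have h5 : q ^ 3 * (q ^ 6 * A.card ^ 3) ≤ q ^ 3 * (7077888 * (A ^ 24).card ^ 5) := by
    calc q ^ 3 * (q ^ 6 * A.card ^ 3) = (q ^ 3) ^ 3 * A.card ^ 3 := by ring
      _ ≤ (2 * Fintype.card (SL2 K)) ^ 3 * (512 * (3 * N x) ^ 3 * (A ^ 24).card ^ 2) :=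
        Nat.mul_le_mul (Nat.pow_le_pow_left h4 3) (hN x)
      _ = 110592 * (Fintype.card (SL2 K) * N x) ^ 3 * (A ^ 24).card ^ 2 := by ring
      _ ≤ 110592 * ((A ^ 24).card * (4 * q)) ^ 3 * (A ^ 24).card ^ 2 := by gcongr
      _ = _ := by ring
  exact Nat.le_of_mul_le_mul_left h5 (by positivity)

/-- Growth in `SL₂(K)`. -/
theorem growth (h2 : (2 : K) ≠ 0) {A : Finset (SL2 K)}
    (h1 : (1 : SL2 K) ∈ A) (hinv : A⁻¹ = A)
    (hgen : Subgroup.closure (A : Set (SL2 K)) = ⊤) :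
    A.card ^ 6 ≤ 4096 * (A ^ 24).card ^ 5 ∨
      Fintype.card K ^ 6 * A.card ^ 3 ≤ 7077888 * (A ^ 24).card ^ 5 := by
  obtain ⟨g, hgA, hg⟩ := exists_trace_sq_ne_four h2 h1 hinv hgen
  have hgc := notMem_center_of_trace_sq_ne_four hg
  by_cases hall : ∀ x : SL2 K, ∃ y ∈ A ^ 2, y ∉ Subgroup.center (SL2 K) ∧
      y * (x * g * x⁻¹) = x * g * x⁻¹ * y
  · exact Or.inr (pow_six_mul_card_pow_three_le h2 h1 hinv hgen hg hall)
  left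
  -- The property holds at x = 1 with witness g. If left multiplication by generators always
  -- preserved it, it would hold everywhere.
  obtain ⟨x, a, ha, ⟨y, hy, hyc, hcomm⟩, hax⟩ : ∃ x : SL2 K, ∃ a ∈ A,
      (∃ y ∈ A ^ 2, y ∉ Subgroup.center (SL2 K) ∧ y * (x * g * x⁻¹) = x * g * x⁻¹ * y) ∧
      ¬ ∃ y ∈ A ^ 2, y ∉ Subgroup.center (SL2 K) ∧
        y * (a * x * g * (a * x)⁻¹) = a * x * g * (a * x)⁻¹ * y := by
    by_contra hcon
    refine hall fun x => ?_
    obtain ⟨n, hn⟩ := exists_mem_pow_of_closure_eq_top hinv hgen x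
    induction n generalizing x with
    | zero =>
      rw [pow_zero, Finset.mem_one] at hn
      subst hn
      exact ⟨g, hgA, hgc, by simp⟩
    | succ n ih =>
      rw [pow_succ'] at hn
      obtain ⟨a, ha, z, hz, rfl⟩ := Finset.mem_mul.1 hn
      by_contra hneg
      exact hcon ⟨z, a, ha, ih z hz, hneg⟩
  have h3 := card_pow_three_le_centralizer h2 h1 hinv hgen hy hyc
  have h4 := card_mul_card_centralizer_le (g := y) hinv ha (by
    intro z hz hzc
    by_contra hzn
    refine hax ⟨z, hz, hzn, ?_⟩
    have e1 : a⁻¹ * z * a * y = y * (a⁻¹ * z * a) := by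
      calc a⁻¹ * z * a * y = a⁻¹ * (z * (a * y * a⁻¹)) * a := by group
        _ = _ := by rw [hzc]; group
    have e2 := commute_trans hyc e1 hcomm.symm
    calc z * (a * x * g * (a * x)⁻¹) = a * (a⁻¹ * z * a * (x * g * x⁻¹)) * a⁻¹ := by group
      _ = _ := by rw [e2]; group)
  have h5 : (A ^ 5).card ≤ (A ^ 24).card :=
    Finset.card_le_card (Finset.pow_subset_pow_right h1 (by norm_num))
  set N := ((A ^ 2).filter fun z => z * y = y * z).card
  calc A.card ^ 6 = A.card ^ 3 * A.card ^ 3 := by ring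
    _ ≤ A.card ^ 3 * (512 * N ^ 3 * (A ^ 24).card ^ 2) := by gcongr
    _ = 512 * (A.card * N) ^ 3 * (A ^ 24).card ^ 2 := by ring
    _ ≤ 512 * (2 * (A ^ 24).card) ^ 3 * (A ^ 24).card ^ 2 :=
      Nat.mul_le_mul_right _ (Nat.mul_le_mul_left _
        (Nat.pow_le_pow_left (h4.trans (Nat.mul_le_mul_left 2 h5)) 3))
    _ = _ := by ring

end Growth

theorem mul_mem_pow_add {G : Type*} [Group G] [DecidableEq G] {A : Finset G} {m n : ℕ} {x y : G}
    (hx : x ∈ A ^ m) (hy : y ∈ A ^ n) : x * y ∈ A ^ (m + n) := by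
  rw [pow_add]; exact Finset.mul_mem_mul hx hy

/-! ### Unipotent factorisation -/

section Unipotent

variable {K : Type*} [Field K]

theorem inv_mul_entry_one_zero (x y : SL2 K) :
    (x⁻¹ * y) 1 0 = x 0 0 * y 1 0 - x 1 0 * y 0 0 := by
  simp [Matrix.mul_apply, Fin.sum_univ_two, Matrix.adjugate_fin_two]
  ring

theorem upper_mul_upper (s t : K) : upper s * upper t = upper (s + t) := by
  apply Subtype.ext
  rw [Matrix.SpecialLinearGroup.coe_mul, upper_val, upper_val, upper_val]
  simp [add_comm]

theorem conj_upper {b : SL2 K} (hb : b 1 0 = 0) (s : K) :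
    b * upper s * b⁻¹ = upper (b 0 0 ^ 2 * s) := by
  have hd := det_eq b
  rw [hb, mul_zero, sub_zero] at hd
  apply Subtype.ext
  rw [Matrix.SpecialLinearGroup.coe_mul, Matrix.SpecialLinearGroup.coe_mul, upper_val, upper_val,
    inv_val]
  ext i j
  fin_cases i <;> fin_cases j <;> simp [Matrix.mul_apply, Fin.sum_univ_two, hb]
  · exact hd
  · ring
  · linear_combination hd

theorem inv_mul_eq_upper {x y : SL2 K} (h0 : x 0 0 = y 0 0) (h1 : x 1 0 = y 1 0) :
    x⁻¹ * y = upper ((x⁻¹ * y) 0 1) := by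
  have dx := det_eq x
  have dy := det_eq y
  rw [Matrix.SpecialLinearGroup.ext_iff]
  simp only [Fin.forall_fin_two, Matrix.SpecialLinearGroup.coe_mul, Matrix.mul_apply,
    Fin.sum_univ_two, inv_val]
  simp [upper_val]
  rw [← h0, ← h1] at dy ⊢
  refine ⟨by linear_combination dx, by ring, by linear_combination dy⟩

theorem weyl_conj_upper (s : K) : weyl * upper s * weyl⁻¹ = lower (-s) := by
  apply Subtype.ext
  rw [Matrix.SpecialLinearGroup.coe_mul, Matrix.SpecialLinearGroup.coe_mul, upper_val, lower_val,
    inv_val, weyl_val]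
  ext i j
  fin_cases i <;> fin_cases j <;> simp [Matrix.mul_apply, Fin.sum_univ_two]

theorem eq_upper_mul_lower_mul_upper {g : SL2 K} (hg : g 1 0 ≠ 0) :
    g = upper ((g 0 0 - 1) / g 1 0) * lower (g 1 0) * upper ((g 1 1 - 1) / g 1 0) := by
  have := det_eq g
  apply Subtype.ext
  rw [Matrix.SpecialLinearGroup.coe_mul, Matrix.SpecialLinearGroup.coe_mul, upper_val, lower_val,
    upper_val]
  ext i j
  fin_cases i <;> fin_cases j <;> simp [Matrix.mul_apply, Fin.sum_univ_two] <;> field_simp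
  · ring
  · linear_combination -this
  · ring

theorem exists_lower_inv_mul_ne_zero (g : SL2 K) : ∃ s : K, ((lower s)⁻¹ * g) 1 0 ≠ 0 := by
  by_cases hg : g 1 0 = 0
  · refine ⟨1, ?_⟩
    have := det_eq g
    rw [hg, mul_zero, sub_zero] at this
    rw [inv_mul_entry_one_zero, hg, lower_val]
    simpa using left_ne_zero_of_mul_eq_one this
  · exact ⟨0, by rw [inv_mul_entry_one_zero, lower_val]; simpa using hg⟩

/-- Off the Borel subgroup g factors as upper · lower · upper; one more lower factor moves any g off
it. -/
theorem mem_pow_of_unipotent_mem_pow [DecidableEq K] {A : Finset (SL2 K)} {n : ℕ}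
    (hU : ∀ s, upper s ∈ A ^ n)
    (hL : ∀ s, lower s ∈ A ^ n) (g : SL2 K) : g ∈ A ^ (n + (n + n + n)) := by
  have h3 : ∀ g : SL2 K, g 1 0 ≠ 0 → g ∈ A ^ (n + n + n) := by
    intro g hg
    rw [eq_upper_mul_lower_mul_upper hg]
    exact mul_mem_pow_add (mul_mem_pow_add (hU _) (hL _)) (hU _)
  obtain ⟨s, hs⟩ := exists_lower_inv_mul_ne_zero g
  have h4 := mul_mem_pow_add (hL s) (h3 _ hs)
  rwa [mul_inv_cancel_left] at h4

end Unipotent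

/-! ### Large sets fill the group -/

section Large

variable {K : Type*} [Field K] [DecidableEq K] [Fintype K]

/-- Among many dilates, one has `X + ξ X` filling more than half of the field. -/
theorem exists_card_lt_two_mul_card_image (X D : Finset K)
    (h : Fintype.card K ^ 2 < D.card * X.card ^ 2) :
    ∃ ξ ∈ D, Fintype.card K <
      2 * ((X ×ˢ X).image fun p : K × K => p.1 + ξ * p.2).card := by
  by_contra! hcon
  set q := Fintype.card K with hq
  set Y : K → Finset K := fun ξ => (X ×ˢ X).image fun p : K × K => p.1 + ξ * p.2 with hY
  set P : Finset ((K × K) × (K × K)) := (X ×ˢ X) ×ˢ (X ×ˢ X) with hP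
  have hPc : P.card = X.card ^ 4 := by
    rw [hP, Finset.card_product, Finset.card_product]; ring
  set Q : K → ℕ := fun ξ => (P.filter fun p => p.1.1 + ξ * p.1.2 = p.2.1 + ξ * p.2.2).card with hQ
  -- `Q ξ` is the additive energy of X and ξX; Cauchy–Schwarz over the fibres of the sum map.
  have hcs : ∀ ξ, X.card ^ 4 ≤ (Y ξ).card * Q ξ := by
    intro ξ
    let r : K → ℕ := fun z => ((X ×ˢ X).filter fun p : K × K => p.1 + ξ * p.2 = z).card
    have hr : (X ×ˢ X).card = ∑ z ∈ Y ξ, r z :=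
      Finset.card_eq_sum_card_fiberwise fun p hp => Finset.mem_image_of_mem _ hp
    have hr2 : Q ξ = ∑ z ∈ Y ξ, r z ^ 2 := by
      rw [hQ]
      simp only
      rw [Finset.card_eq_sum_card_fiberwise (f := fun p : (K × K) × (K × K) => p.1.1 + ξ * p.1.2)
        (t := Y ξ)]
      · refine Finset.sum_congr rfl fun z _ => ?_
        simp only [r]
        rw [pow_two, ← Finset.card_product]
        congr 1
        ext p
        simp only [hP, Finset.mem_filter, Finset.mem_product]
        constructor
        · rintro ⟨⟨⟨h1, h2⟩, h3⟩, h4⟩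
          exact ⟨⟨h1, h4⟩, h2, h3.symm.trans h4⟩
        · rintro ⟨⟨h1, h4⟩, h2, h3⟩
          exact ⟨⟨⟨h1, h2⟩, h4.trans h3.symm⟩, h4⟩
      · intro p hp
        exact Finset.mem_image_of_mem _ (Finset.mem_product.1 (Finset.mem_filter.1 hp).1).1
    calc X.card ^ 4 = (X ×ˢ X).card ^ 2 := by rw [Finset.card_product]; ring
      _ = (∑ z ∈ Y ξ, r z) ^ 2 := by rw [hr]
      _ ≤ (Y ξ).card * ∑ z ∈ Y ξ, r z ^ 2 := sq_sum_le_card_mul_sum_sq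
      _ = _ := by rw [hr2]
  -- Two distinct pairs collide for at most one ξ; equal pairs collide for all q.
  have hsum : ∑ ξ, Q ξ ≤ X.card ^ 4 + q * X.card ^ 2 := by
    have e1 : ∑ ξ, Q ξ = ∑ p ∈ P, ((Finset.univ : Finset K).filter
        fun ξ => p.1.1 + ξ * p.1.2 = p.2.1 + ξ * p.2.2).card := by
      simp only [hQ, Finset.card_filter]
      exact Finset.sum_comm
    have e2 : ∀ p ∈ P, ((Finset.univ : Finset K).filter
        fun ξ => p.1.1 + ξ * p.1.2 = p.2.1 + ξ * p.2.2).card ≤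
          1 + if p.1 = p.2 then q else 0 := by
      rintro ⟨⟨x, y⟩, x', y'⟩ -
      by_cases hp : (x, y) = (x', y')
      · rw [if_pos hp]
        exact (Finset.card_le_univ _).trans (Nat.le_add_left _ _)
      · rw [if_neg hp, add_zero, Finset.card_le_one]
        intro ξ hξ ξ' hξ'
        simp only [Finset.mem_filter, Finset.mem_univ, true_and] at hξ hξ'
        have hy : y ≠ y' := by
          rintro rfl
          exact hp (by rw [add_right_cancel hξ])
        refine mul_right_cancel₀ (sub_ne_zero.2 hy) ?_
        linear_combination hξ - hξ'
    rw [e1]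
    refine (Finset.sum_le_sum e2).trans ?_
    rw [Finset.sum_add_distrib, Finset.sum_const, smul_eq_mul, mul_one, hPc]
    gcongr
    rw [← Finset.sum_filter, Finset.sum_const, smul_eq_mul, mul_comm]
    gcongr
    calc _ ≤ (X ×ˢ X).card := by
          refine Finset.card_le_card_of_injOn Prod.fst ?_ ?_
          · intro p hp
            exact (Finset.mem_product.1 (Finset.mem_filter.1 hp).1).1
          · intro p hp p' hp' e
            exact Prod.ext e (((Finset.mem_filter.1 hp).2.symm.trans e).trans
              (Finset.mem_filter.1 hp').2)
      _ = _ := by rw [Finset.card_product]; ring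
  -- Every ξ has energy at least |X|⁴/q, and by `hcon` those in D have twice as much.
  have hlow : q * X.card ^ 4 + D.card * X.card ^ 4 ≤ q * ∑ ξ, Q ξ := by
    have e : q * X.card ^ 4 + D.card * X.card ^ 4 =
        ∑ ξ : K, (X.card ^ 4 + if ξ ∈ D then X.card ^ 4 else 0) := by
      rw [Finset.sum_add_distrib, Finset.sum_ite_mem, Finset.univ_inter]
      simp [hq]
    rw [e, Finset.mul_sum]
    refine Finset.sum_le_sum fun ξ _ => ?_
    by_cases hξ : ξ ∈ D
    · rw [if_pos hξ]
      calc X.card ^ 4 + X.card ^ 4 = 2 * X.card ^ 4 := by ring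
        _ ≤ 2 * ((Y ξ).card * Q ξ) := Nat.mul_le_mul_left _ (hcs ξ)
        _ = 2 * (Y ξ).card * Q ξ := by ring
        _ ≤ q * Q ξ := Nat.mul_le_mul_right _ (hcon ξ hξ)
    · rw [if_neg hξ, add_zero]
      exact (hcs ξ).trans (Nat.mul_le_mul_right _ (Finset.card_le_univ _))
  have h1 : D.card * X.card ^ 4 ≤ q ^ 2 * X.card ^ 2 := by
    have := Nat.mul_le_mul_left q hsum
    nlinarith
  have hX : 0 < X.card ^ 2 := by
    rcases Nat.eq_zero_or_pos (X.card ^ 2) with h0 | h0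
    · rw [h0] at h; omega
    · exact h0
  have h2 := Nat.mul_lt_mul_of_pos_right h hX
  nlinarith

/-- Pigeonhole: Y and s − Y cannot be disjoint. -/
theorem exists_add_eq_of_card_lt {Y : Finset K} (hY : Fintype.card K < 2 * Y.card) (s : K) :
    ∃ y ∈ Y, ∃ z ∈ Y, y + z = s := by
  by_contra! h
  have hd : Disjoint Y (Y.image fun z => s - z) := by
    rw [Finset.disjoint_left]
    intro y hy hy'
    obtain ⟨z, hz, e⟩ := Finset.mem_image.1 hy'
    exact h y hy z hz (by rw [← e]; ring)
  have h1 := Finset.card_union_of_disjoint hd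
  rw [Finset.card_image_of_injective _ sub_right_injective] at h1
  have h2 := Finset.card_le_univ (Y ∪ Y.image fun z => s - z)
  omega

/-- Pigeonhole on the first column, which determines the coset of the upper unipotent subgroup. -/
theorem card_le_card_upper_mul {A : Finset (SL2 K)} (hinv : A⁻¹ = A) :
    A.card ≤ ((Finset.univ : Finset K).filter fun s => upper s ∈ A ^ 2).card *
      Fintype.card K ^ 2 := by
  have hinvm : ∀ a ∈ A, a⁻¹ ∈ A := fun a ha => by rw [← hinv]; exact Finset.inv_mem_inv ha
  have h := Finset.card_le_mul_card_image_of_maps_to (s := A)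
    (f := fun a : SL2 K => (a 0 0, a 1 0)) (t := Finset.univ) (fun _ _ => Finset.mem_univ _)
    ((Finset.univ : Finset K).filter fun s => upper s ∈ A ^ 2).card ?_
  · rwa [Finset.card_univ, Fintype.card_prod, ← pow_two] at h
  · intro b _
    rcases (A.filter fun a : SL2 K => (a 0 0, a 1 0) = b).eq_empty_or_nonempty with h0 | ⟨a₀, h0⟩
    · simp [h0]
    obtain ⟨ha₀, hb₀⟩ := Finset.mem_filter.1 h0
    have key : ∀ a ∈ A.filter fun a : SL2 K => (a 0 0, a 1 0) = b,
        a ∈ A ∧ a₀⁻¹ * a = upper ((a₀⁻¹ * a) 0 1) := by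
      intro a ha
      obtain ⟨ha, hb⟩ := Finset.mem_filter.1 ha
      have := hb₀.trans hb.symm
      simp only [Prod.mk.injEq] at this
      exact ⟨ha, inv_mul_eq_upper this.1 this.2⟩
    refine Finset.card_le_card_of_injOn (fun a => (a₀⁻¹ * a) 0 1) ?_ ?_
    · intro a ha
      obtain ⟨ha, e⟩ := key a ha
      refine Finset.mem_coe.2 (Finset.mem_filter.2 ⟨Finset.mem_univ _, ?_⟩)
      rw [← e, pow_two]
      exact Finset.mul_mem_mul (hinvm _ ha₀) ha
    · intro a ha a' ha' e
      have e1 := (key a ha).2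
      have e2 := (key a' ha').2
      simp only at e
      rw [e, ← e2] at e1
      exact mul_left_cancel e1

/-- Pigeonhole on the projective line, with `none` as the point at infinity: a fibre lies in one
coset of the Borel subgroup. -/
theorem card_le_card_borel_mul {A : Finset (SL2 K)} (hinv : A⁻¹ = A) :
    A.card ≤ ((A ^ 2).filter fun b : SL2 K => b 1 0 = 0).card * (Fintype.card K + 1) := by
  have hinvm : ∀ a ∈ A, a⁻¹ ∈ A := fun a ha => by rw [← hinv]; exact Finset.inv_mem_inv ha
  let f : SL2 K → Option K := fun a => if a 0 0 = 0 then none else some (a 1 0 / a 0 0)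
  have h := Finset.card_le_mul_card_image_of_maps_to (s := A)
    (f := f) (t := Finset.univ) (fun _ _ => Finset.mem_univ _)
    ((A ^ 2).filter fun b : SL2 K => b 1 0 = 0).card ?_
  · rwa [Finset.card_univ, Fintype.card_option] at h
  · intro b _
    rcases (A.filter fun a => f a = b).eq_empty_or_nonempty with h0 | ⟨a₀, h0⟩
    · simp [h0]
    obtain ⟨ha₀, hb₀⟩ := Finset.mem_filter.1 h0
    refine Finset.card_le_card_of_injOn (fun a => a₀⁻¹ * a) ?_ fun a _ b _ h => mul_left_cancel h
    intro a ha
    obtain ⟨ha, hb⟩ := Finset.mem_filter.1 ha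
    refine Finset.mem_coe.2 (Finset.mem_filter.2 ⟨?_, ?_⟩)
    · rw [pow_two]; exact Finset.mul_mem_mul (hinvm _ ha₀) ha
    · have e := hb₀.trans hb.symm
      rw [inv_mul_entry_one_zero]
      simp only [f] at e
      split_ifs at e with h1 h2 h2
      · rw [h1, h2]; ring
      · have := Option.some.inj e
        field_simp at this
        linear_combination -this

theorem card_borel_le {s : Finset (SL2 K)} (hs : ∀ b ∈ s, b 1 0 = 0) :
    s.card ≤ 2 * ((s.image fun b : SL2 K => b 0 0 ^ 2).card * Fintype.card K) := by
  have h := Finset.card_le_mul_card_image_of_maps_to (s := s)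
    (f := fun b : SL2 K => (b 0 0 ^ 2, b 0 1))
    (t := (s.image fun b : SL2 K => b 0 0 ^ 2) ×ˢ (Finset.univ : Finset K))
    (fun b hb => Finset.mem_product.2 ⟨Finset.mem_image_of_mem _ hb, Finset.mem_univ _⟩) 2 ?_
  · rwa [Finset.card_product, Finset.card_univ] at h
  · rintro ⟨d, e⟩ -
    by_contra! hc
    obtain ⟨x, hx, y, hy, z, hz, hxy, hxz, hyz⟩ := Finset.two_lt_card.1 hc
    have key : ∀ b ∈ s.filter fun b : SL2 K => (b 0 0 ^ 2, b 0 1) = (d, e),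
        b 0 0 ^ 2 = d ∧ b 0 1 = e ∧ b 1 0 = 0 ∧ b 0 0 * b 1 1 = 1 := by
      intro b hb
      obtain ⟨hb, h⟩ := Finset.mem_filter.1 hb
      simp only [Prod.mk.injEq] at h
      have := det_eq b
      rw [hs b hb, mul_zero, sub_zero] at this
      exact ⟨h.1, h.2, hs b hb, this⟩
    have inj : ∀ b ∈ s.filter fun b : SL2 K => (b 0 0 ^ 2, b 0 1) = (d, e),
        ∀ b' ∈ s.filter fun b : SL2 K => (b 0 0 ^ 2, b 0 1) = (d, e), b 0 0 = b' 0 0 → b = b' := by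
      intro b hb b' hb' h
      obtain ⟨-, h1, h2, h3⟩ := key b hb
      obtain ⟨-, h1', h2', h3'⟩ := key b' hb'
      have h4 : b 1 1 = b' 1 1 := by
        rw [h] at h3
        have h5 : b' 0 0 ≠ 0 := left_ne_zero_of_mul_eq_one h3'
        exact mul_left_cancel₀ h5 (h3.trans h3'.symm)
      rw [Matrix.SpecialLinearGroup.ext_iff]
      simp only [Fin.forall_fin_two]
      exact ⟨⟨h, h1.trans h1'.symm⟩, h2.trans h2'.symm, h4⟩
    rcases sq_eq_sq_iff_eq_or_eq_neg.1 ((key x hx).1.trans (key y hy).1.symm) with h1 | h1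
    · exact hxy (inj x hx y hy h1)
    rcases sq_eq_sq_iff_eq_or_eq_neg.1 ((key x hx).1.trans (key z hz).1.symm) with h2 | h2
    · exact hxz (inj x hx z hz h2)
    · exact hyz (inj y hy z hz (neg_injective (h1.symm.trans h2)))

/-- A very large symmetric set covers the upper unipotent subgroup in sixteen steps. -/
theorem upper_mem_pow (hq : 256 ≤ Fintype.card K) {A : Finset (SL2 K)} (hinv : A⁻¹ = A)
    (hA : Fintype.card K ^ 11 < A.card ^ 4) (s : K) : upper s ∈ A ^ 16 := by
  set q := Fintype.card K with hqdef
  set X := (Finset.univ : Finset K).filter fun s => upper s ∈ A ^ 2 with hX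
  set B := (A ^ 2).filter fun b : SL2 K => b 1 0 = 0 with hB
  set D := B.image fun b : SL2 K => b 0 0 ^ 2 with hD
  have h1 : A.card ≤ X.card * q ^ 2 := card_le_card_upper_mul hinv
  have h2 : A.card ≤ 2 * (D.card * q) * (q + 1) :=
    (card_le_card_borel_mul hinv).trans (Nat.mul_le_mul_right _
      (card_borel_le fun b hb => (Finset.mem_filter.1 hb).2))
  -- Failure would give |A|³ ≤ 4q⁸, whereas |A|³ > q^(33/4); the bound q ≥ 256 is exactly q^(1/4) ≥
  -- 4.
  have h3 : q ^ 2 < D.card * X.card ^ 2 := by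
    by_contra! hcon
    have h4 : A.card ^ 3 ≤ 4 * q ^ 8 := by
      calc A.card ^ 3 = A.card ^ 2 * A.card := by ring
        _ ≤ (X.card * q ^ 2) ^ 2 * (2 * (D.card * q) * (q + 1)) :=
          Nat.mul_le_mul (Nat.pow_le_pow_left h1 2) h2
        _ = (D.card * X.card ^ 2) * (2 * q ^ 5 * (q + 1)) := by ring
        _ ≤ q ^ 2 * (2 * q ^ 5 * (q + q)) := by
          refine Nat.mul_le_mul hcon (Nat.mul_le_mul_left _ ?_)
          omega
        _ = _ := by ring
    have h5 : q ^ 33 < 256 * q ^ 32 := by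
      calc q ^ 33 = (q ^ 11) ^ 3 := by ring
        _ < (A.card ^ 4) ^ 3 := Nat.pow_lt_pow_left hA (by norm_num)
        _ = (A.card ^ 3) ^ 4 := by ring
        _ ≤ (4 * q ^ 8) ^ 4 := Nat.pow_le_pow_left h4 4
        _ = _ := by ring
    have h6 : 256 * q ^ 32 ≤ q ^ 33 := by
      rw [pow_succ q 32, mul_comm]; exact Nat.mul_le_mul_left _ hq
    omega
  obtain ⟨ξ, hξ, hY⟩ := exists_card_lt_two_mul_card_image X D h3
  obtain ⟨b, hb, rfl⟩ := Finset.mem_image.1 hξ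
  obtain ⟨hbA, hb0⟩ := Finset.mem_filter.1 hb
  have hinv2 : b⁻¹ ∈ A ^ 2 := by
    rw [← hinv, inv_pow]; exact Finset.inv_mem_inv hbA
  have h8 : ∀ y ∈ (X ×ˢ X).image fun p : K × K => p.1 + b 0 0 ^ 2 * p.2, upper y ∈ A ^ 8 := by
    intro y hy
    obtain ⟨⟨x, z⟩, hxz, rfl⟩ := Finset.mem_image.1 hy
    obtain ⟨hx, hz⟩ := Finset.mem_product.1 hxz
    have : A ^ 8 = A ^ 2 * (A ^ 2 * A ^ 2 * A ^ 2) := by simp only [← pow_add]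
    rw [← upper_mul_upper, ← conj_upper hb0, this]
    exact Finset.mul_mem_mul (Finset.mem_filter.1 hx).2 (Finset.mul_mem_mul
      (Finset.mul_mem_mul hbA (Finset.mem_filter.1 hz).2) hinv2)
  obtain ⟨y, hy, z, hz, rfl⟩ := exists_add_eq_of_card_lt hY s
  have : A ^ 16 = A ^ 8 * A ^ 8 := by rw [← pow_add]
  rw [← upper_mul_upper, this]
  exact Finset.mul_mem_mul (h8 y hy) (h8 z hz)

/-- Apply the upper case to the conjugate of A by the inverse Weyl element. -/
theorem lower_mem_pow (hq : 256 ≤ Fintype.card K) {A : Finset (SL2 K)} (hinv : A⁻¹ = A)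
    (hA : Fintype.card K ^ 11 < A.card ^ 4) (s : K) : lower s ∈ A ^ 16 := by
  let f : SL2 K →* SL2 K := (MulAut.conj (weyl : SL2 K)⁻¹).toMonoidHom
  have hf : Function.Injective f := (MulAut.conj (weyl : SL2 K)⁻¹).injective
  have h := upper_mem_pow hq (A := A.image f) ?_ ?_ (-s)
  · rw [← Finset.image_pow] at h
    obtain ⟨a, ha, e⟩ := Finset.mem_image.1 h
    have e' : weyl * upper (-s) * weyl⁻¹ = a := by
      rw [← e]; simp [f, mul_assoc]
    rw [weyl_conj_upper, neg_neg] at e'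
    rwa [e']
  · rw [← Finset.image_inv, hinv]
  · rwa [Finset.card_image_of_injective _ hf]

/-- A very large symmetric set covers `SL₂(K)` in boundedly many steps. -/
theorem pow_eq_univ_of_large (hq : 256 ≤ Fintype.card K) {A : Finset (SL2 K)} (hinv : A⁻¹ = A)
    (hA : Fintype.card K ^ 11 < A.card ^ 4) : A ^ 64 = Finset.univ := by
  obtain ⟨n, hn⟩ : ∃ n, n = 16 := ⟨_, rfl⟩
  have hU : ∀ s : K, upper s ∈ A ^ n := hn ▸ upper_mem_pow hq hinv hA
  have hL : ∀ s : K, lower s ∈ A ^ n := hn ▸ lower_mem_pow hq hinv hA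
  have e : 64 = n + (n + n + n) := by omega
  rw [e]
  exact Finset.eq_univ_iff_forall.2 (mem_pow_of_unipotent_mem_pow hU hL)

end Large

/-! ### Powers of a symmetric generating set -/

section Covering

variable {G : Type*} [Group G] [DecidableEq G]

theorem inv_pow_eq {A : Finset G} (hinv : A⁻¹ = A) (n : ℕ) : (A ^ n)⁻¹ = A ^ n := by
  rw [← inv_pow, hinv]

theorem closure_pow_eq_top {A : Finset G} (h1 : (1 : G) ∈ A)
    (hgen : Subgroup.closure (A : Set G) = ⊤) {n : ℕ} (hn : n ≠ 0) :
    Subgroup.closure ((A ^ n : Finset G) : Set G) = ⊤ := by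
  rw [eq_top_iff, ← hgen]
  exact Subgroup.closure_mono (Finset.coe_subset.2 (Finset.subset_pow h1 hn))

/-- The powers increase strictly until they stall, and once they stall they contain everything
generated. -/
theorem lt_card_pow_of_ne_univ [Fintype G] {A : Finset G} (h1 : (1 : G) ∈ A) (hinv : A⁻¹ = A)
    (hgen : Subgroup.closure (A : Set G) = ⊤) (n : ℕ) (hn : A ^ n ≠ Finset.univ) :
    n < (A ^ n).card := by
  induction n with
  | zero => simp
  | succ n ih =>
    have hsub : A ^ n ⊆ A ^ (n + 1) := Finset.pow_subset_pow_right h1 n.le_succ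
    have hn' : A ^ n ≠ Finset.univ := fun h => hn (Finset.univ_subset_iff.1 (h ▸ hsub))
    have h := ih hn'
    by_contra hcon
    have heq : A ^ n = A ^ (n + 1) := Finset.eq_of_subset_of_card_le hsub (by omega)
    have hst : ∀ m, A ^ (n + m) = A ^ n := by
      intro m
      induction m with
      | zero => rfl
      | succ m ihm => rw [← add_assoc, pow_succ, ihm, ← pow_succ, ← heq]
    refine hn' (Finset.eq_univ_iff_forall.2 fun g => ?_)
    obtain ⟨m, hm⟩ := exists_mem_pow_of_closure_eq_top hinv hgen g
    rw [← hst m]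
    exact Finset.pow_subset_pow_right h1 (Nat.le_add_left m n) hm

theorem insert_one_union_inv (A : Finset G) :
    (insert 1 (A ∪ A⁻¹))⁻¹ = insert 1 (A ∪ A⁻¹) := by
  ext x; simp [Finset.mem_inv', or_comm]

end Covering

/-! ### From product sets to graph distance -/

section Diameter

variable {G : Type*} [Group G] [DecidableEq G]

theorem edist_mul_le {A : Finset G} {n : ℕ} {x : G} (hx : x ∈ (insert 1 (A ∪ A⁻¹)) ^ n) (u : G) :
    (SimpleGraph.mulCayley (A : Set G)).edist u (u * x) ≤ n := by
  induction n generalizing x with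
  | zero =>
    rw [pow_zero, Finset.mem_one] at hx
    simp [hx]
  | succ n ih =>
    rw [pow_succ] at hx
    obtain ⟨y, hy, a, ha, rfl⟩ := Finset.mem_mul.1 hx
    refine (SimpleGraph.edist_triangle (v := u * y)).trans ?_
    push_cast
    refine add_le_add (ih hy) ?_
    by_cases h1 : a = 1
    · simp [h1]
    · refine (SimpleGraph.edist_eq_one_iff_adj.2 ?_).le
      rw [SimpleGraph.mulCayley_adj]
      refine ⟨by simpa [mul_assoc] using h1, ?_⟩
      simpa [h1, mul_assoc] using ha

theorem ediam_mulCayley_le {A : Finset G} {n : ℕ} (h : ∀ x : G, x ∈ (insert 1 (A ∪ A⁻¹)) ^ n) :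
    (SimpleGraph.mulCayley (A : Set G)).ediam ≤ n :=
  SimpleGraph.ediam_le_of_edist_le fun u v => by
    simpa using edist_mul_le (h (u⁻¹ * v)) u

theorem diam_mulCayley_le {A : Finset G} {n : ℕ} (h : ∀ x : G, x ∈ (insert 1 (A ∪ A⁻¹)) ^ n) :
    (SimpleGraph.mulCayley (A : Set G)).diam ≤ n :=
  ENat.toNat_le_of_le_natCast (ediam_mulCayley_le h)

theorem closure_insert_one_union_inv {A : Finset G} (hgen : Subgroup.closure (A : Set G) = ⊤) :
    Subgroup.closure ((insert 1 (A ∪ A⁻¹) : Finset G) : Set G) = ⊤ := by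
  rw [eq_top_iff, ← hgen]
  refine Subgroup.closure_mono (Finset.coe_subset.2 ?_)
  exact Finset.subset_union_left.trans (Finset.subset_insert _ _)

theorem mem_pow_card [Fintype G] {A : Finset G} (hgen : Subgroup.closure (A : Set G) = ⊤)
    (x : G) : x ∈ (insert 1 (A ∪ A⁻¹)) ^ Fintype.card G := by
  by_contra hx
  have := lt_card_pow_of_ne_univ (A := insert 1 (A ∪ A⁻¹)) (Finset.mem_insert_self _ _)
    (insert_one_union_inv A) (closure_insert_one_union_inv hgen) (Fintype.card G)
    fun h => hx (h ▸ Finset.mem_univ x)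
  exact absurd (Finset.card_le_univ _) (not_le.2 this)

end Diameter

/-! ### Iterating growth -/

section Iteration

variable {K : Type*} [Field K] [DecidableEq K] [Fintype K]

theorem card_SL2_le : Fintype.card (SL2 K) ≤ Fintype.card K ^ 4 := by
  refine (Fintype.card_subtype_le _).trans (le_of_eq ?_)
  exact (Fintype.card_fun (α := Fin 2) (β := Fin 2 → K)).trans (by
    rw [Fintype.card_fun, Fintype.card_fin, ← pow_mul])

/-- In the second growth alternative, |A|⁴ ≤ q¹¹ trades q for |A|, leaving |A|⁵⁷ ≤ 7077888¹¹
|A^24|⁵⁵. Since 7077888 < 2²³, the size 2²⁵³ = (2²³)¹¹ absorbs the constant for one factor |A|. -/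
theorem growth_or_covers (h2 : (2 : K) ≠ 0) (hq : 256 ≤ Fintype.card K) {A : Finset (SL2 K)}
    (h1 : (1 : SL2 K) ∈ A) (hinv : A⁻¹ = A) (hgen : Subgroup.closure (A : Set (SL2 K)) = ⊤)
    (hA : 2 ^ 253 ≤ A.card) : A ^ 64 = Finset.univ ∨ A.card ^ 56 ≤ (A ^ 24).card ^ 55 := by
  rcases lt_or_ge (Fintype.card K ^ 11) (A.card ^ 4) with hl | hl
  · exact Or.inl (pow_eq_univ_of_large hq hinv hl)
  right
  have h0 : 0 < A.card := lt_of_lt_of_le (by positivity) hA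
  set a := A.card
  set m := (A ^ 24).card
  set q := Fintype.card K
  rcases growth h2 h1 hinv hgen with h | h
  · have e1 : 4096 ^ 11 ≤ a ^ 10 :=
      le_trans (by norm_num) (Nat.pow_le_pow_left hA 10)
    refine Nat.le_of_mul_le_mul_left (?_ : 4096 ^ 11 * _ ≤ 4096 ^ 11 * _) (by positivity)
    calc 4096 ^ 11 * a ^ 56 ≤ a ^ 10 * a ^ 56 := Nat.mul_le_mul_right _ e1
      _ = (a ^ 6) ^ 11 := by ring
      _ ≤ (4096 * m ^ 5) ^ 11 := Nat.pow_le_pow_left h 11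
      _ = 4096 ^ 11 * m ^ 55 := by rw [mul_pow, ← pow_mul]
  · have e1 : 7077888 ^ 11 ≤ a := le_trans (by norm_num) hA
    refine Nat.le_of_mul_le_mul_left (?_ : 7077888 ^ 11 * _ ≤ 7077888 ^ 11 * _) (by positivity)
    calc 7077888 ^ 11 * a ^ 56 ≤ a * a ^ 56 := Nat.mul_le_mul_right _ e1
      _ = (a ^ 4) ^ 6 * a ^ 33 := by ring
      _ ≤ (q ^ 11) ^ 6 * a ^ 33 := Nat.mul_le_mul_right _ (Nat.pow_le_pow_left hl 6)
      _ = (q ^ 6 * a ^ 3) ^ 11 := by ring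
      _ ≤ (7077888 * m ^ 5) ^ 11 := Nat.pow_le_pow_left h 11
      _ = 7077888 ^ 11 * m ^ 55 := by rw [mul_pow, ← pow_mul]

theorem card_pow_le_of_ne_univ (h2 : (2 : K) ≠ 0) (hq : 256 ≤ Fintype.card K)
    {A : Finset (SL2 K)} (h1 : (1 : SL2 K) ∈ A) (hinv : A⁻¹ = A)
    (hgen : Subgroup.closure (A : Set (SL2 K)) = ⊤) (hA : 2 ^ 253 ≤ A.card) (r : ℕ)
    (hr : A ^ (24 ^ r * 64) ≠ Finset.univ) :
    A.card ^ 56 ^ r ≤ (A ^ 24 ^ r).card ^ 55 ^ r := by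
  induction r with
  | zero => simp
  | succ r ih =>
    have hsub : A ^ (24 ^ r * 64) ⊆ A ^ (24 ^ (r + 1) * 64) :=
      Finset.pow_subset_pow_right h1 (Nat.mul_le_mul_right _
        (Nat.pow_le_pow_right (by norm_num) r.le_succ))
    have hr' : A ^ (24 ^ r * 64) ≠ Finset.univ :=
      fun h => hr (Finset.univ_subset_iff.1 (h ▸ hsub))
    have hpos : 24 ^ r ≠ 0 := by positivity
    have hcard : A.card ≤ (A ^ 24 ^ r).card := Finset.card_le_card (Finset.subset_pow h1 hpos)
    have hg := (growth_or_covers h2 hq (A := A ^ 24 ^ r) (Finset.one_mem_pow h1)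
      (inv_pow_eq hinv _) (closure_pow_eq_top h1 hgen hpos) (hA.trans hcard)).resolve_left
      (by rwa [← pow_mul])
    rw [← pow_mul] at hg
    rw [pow_succ 56, pow_succ 55, pow_succ 24, pow_mul, mul_comm (55 ^ r), pow_mul]
    calc (A.card ^ 56 ^ r) ^ 56 ≤ ((A ^ 24 ^ r).card ^ 55 ^ r) ^ 56 :=
          Nat.pow_le_pow_left (ih hr') 56
      _ = ((A ^ 24 ^ r).card ^ 56) ^ 55 ^ r := by rw [← pow_mul, ← pow_mul, mul_comm]
      _ ≤ _ := Nat.pow_le_pow_left hg _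

/-- The initial power n raises the size to the threshold 2²⁵³. If r rounds of growth still did not
cover, the bound |G| ≤ q⁴ would give (56/55)^r log 2 ≤ 4 log q, impossible as log 2 > 1/2. -/
theorem pow_eq_univ_of_log_le (h2 : (2 : K) ≠ 0) (hq : 256 ≤ Fintype.card K)
    {A : Finset (SL2 K)} (h1 : (1 : SL2 K) ∈ A) (hinv : A⁻¹ = A)
    (hgen : Subgroup.closure (A : Set (SL2 K)) = ⊤) {n r : ℕ} (hn : 2 ^ 253 ≤ n)
    (hr : 8 * Real.log (Fintype.card K) ≤ (56 / 55 : ℝ) ^ r) :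
    A ^ (n * (24 ^ r * 64)) = Finset.univ := by
  by_contra hne
  rw [pow_mul] at hne
  have hn0 : n ≠ 0 := (lt_of_lt_of_le (by positivity) hn).ne'
  set B := A ^ n with hB
  have hB1 : (1 : SL2 K) ∈ B := Finset.one_mem_pow h1
  have hBne : B ≠ Finset.univ := fun h => hne (by
    refine Finset.univ_subset_iff.1 ?_
    rw [← h]
    exact Finset.subset_pow hB1 (by positivity))
  have hBc : 2 ^ 253 ≤ B.card := hn.trans (lt_card_pow_of_ne_univ h1 hinv hgen _ hBne).le
  have h := card_pow_le_of_ne_univ h2 hq hB1 (inv_pow_eq hinv _) (closure_pow_eq_top h1 hgen hn0)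
    hBc r hne
  set q := Fintype.card K with hqd
  have hqr : (256 : ℝ) ≤ q := by exact_mod_cast hq
  have h3 : (2 : ℕ) ^ 56 ^ r ≤ (q ^ 4) ^ 55 ^ r := by
    calc 2 ^ 56 ^ r ≤ B.card ^ 56 ^ r := Nat.pow_le_pow_left (le_trans (by norm_num) hBc) _
      _ ≤ _ := h
      _ ≤ _ := Nat.pow_le_pow_left ((Finset.card_le_univ _).trans card_SL2_le) _
  have h4 : (2 : ℝ) ^ 56 ^ r ≤ ((q : ℝ) ^ 4) ^ 55 ^ r := by exact_mod_cast h3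
  have h5 := Real.log_le_log (by positivity) h4
  rw [Real.log_pow, Real.log_pow, Real.log_pow] at h5
  push_cast at h5
  have h6 : (56 / 55 : ℝ) ^ r * Real.log 2 ≤ 4 * Real.log q := by
    rw [div_pow, div_mul_eq_mul_div, div_le_iff₀ (by positivity)]
    linarith
  have h7 : 0 < Real.log q := Real.log_pos (by linarith)
  have h8 := Real.log_two_gt_d9
  nlinarith

end Iteration

/-! ### The diameter exponent -/

/-- The exponent obtained for the diameter of `SL₂`. -/
noncomputable def diameterExponent : ℝ := Real.log 24 / Real.log (56 / 55)

theorem diameterExponent_nonneg : 0 ≤ diameterExponent :=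
  div_nonneg (Real.log_nonneg (by norm_num)) (Real.log_nonneg (by norm_num))

theorem exists_growth_steps {x : ℝ} (hx : 1 ≤ x) :
    ∃ r : ℕ, x ≤ (56 / 55 : ℝ) ^ r ∧ (24 : ℝ) ^ r ≤ 24 * x ^ diameterExponent := by
  have hl : 0 < Real.log (56 / 55) := Real.log_pos (by norm_num)
  have hx0 : 0 < x := by linarith
  set y := Real.log x / Real.log (56 / 55) with hy
  have hy0 : 0 ≤ y := div_nonneg (Real.log_nonneg hx) hl.le
  refine ⟨⌈y⌉₊, ?_, ?_⟩
  · rw [← Real.rpow_natCast]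
    calc x = (56 / 55 : ℝ) ^ y := by
          rw [Real.rpow_def_of_pos (by norm_num), hy, mul_div_cancel₀ _ hl.ne', Real.exp_log hx0]
      _ ≤ _ := Real.rpow_le_rpow_of_exponent_le (by norm_num) (Nat.le_ceil _)
  · rw [← Real.rpow_natCast]
    calc (24 : ℝ) ^ ((⌈y⌉₊ : ℕ) : ℝ) ≤ 24 ^ (1 + y) :=
          Real.rpow_le_rpow_of_exponent_le (by norm_num)
            (by linarith [(Nat.ceil_lt_add_one hy0).le])
      _ = 24 * 24 ^ y := by rw [Real.rpow_add (by norm_num), Real.rpow_one]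
      _ = _ := by
        rw [Real.rpow_def_of_pos (by norm_num : (0 : ℝ) < 24), Real.rpow_def_of_pos hx0, hy,
          diameterExponent]
        congr 2
        ring

theorem isDiameterExponent_diameterExponent : IsDiameterExponent diameterExponent := by
  set c := diameterExponent with hc
  have hc0 : 0 ≤ c := diameterExponent_nonneg
  have hl2 : 0 < Real.log 2 := Real.log_pos (by norm_num)
  -- The first summand serves p ≥ 256; the second serves smaller primes, where the diameter is at
  -- most |G| ≤ 256⁴.
  refine ⟨2 ^ 253 * (24 * 8 ^ c * 64) + 256 ^ 4 / Real.log 2 ^ c, ?_⟩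
  intro p hp A hgen
  have hp2 : (2 : ℝ) ≤ p := by exact_mod_cast hp.out.two_le
  have hlp : Real.log 2 ≤ Real.log p := Real.log_le_log (by norm_num) hp2
  have hlp0 : 0 < Real.log p := hl2.trans_le hlp
  have hpc : 0 < Real.log p ^ c := Real.rpow_pos_of_pos hlp0 _
  rw [add_mul]
  rcases lt_or_ge p 256 with hsmall | hbig
  · have h1 : (SimpleGraph.mulCayley (A : Set (SL2 (ZMod p)))).diam ≤ 256 ^ 4 :=
      (diam_mulCayley_le (mem_pow_card hgen)).trans (card_SL2_le.trans (by
        rw [ZMod.card]; exact Nat.pow_le_pow_left hsmall.le 4))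
    have h2 : ((SimpleGraph.mulCayley (A : Set (SL2 (ZMod p)))).diam : ℝ) ≤ 256 ^ 4 := by
      exact_mod_cast h1
    have h3 : (256 : ℝ) ^ 4 ≤ 256 ^ 4 / Real.log 2 ^ c * Real.log p ^ c := by
      rw [div_mul_eq_mul_div, le_div_iff₀ (Real.rpow_pos_of_pos hl2 _)]
      exact mul_le_mul_of_nonneg_left (Real.rpow_le_rpow hl2.le hlp hc0) (by positivity)
    have h4 : 0 ≤ 2 ^ 253 * (24 * (8 : ℝ) ^ c * 64) * Real.log p ^ c := by positivity
    exact (h2.trans h3).trans (le_add_of_nonneg_left h4)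
  · have h2 : (2 : ZMod p) ≠ 0 := by
      intro h
      have : ((2 : ℕ) : ZMod p) = 0 := by exact_mod_cast h
      rw [ZMod.natCast_eq_zero_iff] at this
      have := Nat.le_of_dvd (by norm_num) this
      omega
    have hx : 1 ≤ 8 * Real.log p := by
      have := Real.log_two_gt_d9; linarith
    obtain ⟨r, hr, hr'⟩ := exists_growth_steps hx
    obtain ⟨n, hn⟩ : ∃ n : ℕ, n = 2 ^ 253 := ⟨_, rfl⟩
    have hcov := pow_eq_univ_of_log_le h2 (by rw [ZMod.card]; exact hbig)
      (A := insert 1 (A ∪ A⁻¹)) (Finset.mem_insert_self _ _) (insert_one_union_inv A)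
      (closure_insert_one_union_inv hgen) (r := r) hn.ge (by rwa [ZMod.card])
    have h3 := diam_mulCayley_le (A := A) fun x => hcov ▸ Finset.mem_univ x
    have h4 : ((SimpleGraph.mulCayley (A : Set (SL2 (ZMod p)))).diam : ℝ) ≤
        2 ^ 253 * (24 ^ r * 64) := by rw [hn] at h3; exact_mod_cast h3
    have h5 : (2 : ℝ) ^ 253 * (24 ^ r * 64) ≤
        2 ^ 253 * (24 * 8 ^ c * 64) * Real.log p ^ c := by
      rw [Real.mul_rpow (by norm_num) hlp0.le] at hr'
      calc (2 : ℝ) ^ 253 * (24 ^ r * 64) ≤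
            2 ^ 253 * (24 * (8 ^ c * Real.log p ^ c) * 64) := by gcongr
        _ = _ := by ring
    have h6 : 0 ≤ 256 ^ 4 / Real.log 2 ^ c * Real.log p ^ c := by positivity
    exact (h4.trans h5).trans (le_add_of_nonneg_right h6)

end SL2Growth

/-! ### Combining the mixing bound with the diameter bound -/

theorem mainTheorem4 :
    (∃ c : ℝ, IsDiameterExponent c) ∧
    ∀ c : ℝ, IsDiameterExponent c →
      ∃ C : ℝ, 0 < C ∧
        ∀ (p : ℕ) [Fact p.Prime] (A : Finset (Matrix.SpecialLinearGroup (Fin 2) (ZMod p))),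
          Subgroup.closure (A : Set (Matrix.SpecialLinearGroup (Fin 2) (ZMod p))) = ⊤ →
            ∃ t : ℕ, IsMixingTime A t ∧
              (t : ℝ) ≤ C * (A.card : ℝ) * Real.log p ^ (2 * c + 1) := by
  refine ⟨⟨_, SL2Growth.isDiameterExponent_diameterExponent⟩, ?_⟩
  rintro c ⟨K, hK⟩
  -- 48 = 4 · 2 · 6: the 4 absorbs the rounding term, |S| ≤ 2|A|, and log(4|G|) ≤ 6 log p. The extra
  -- 1 keeps the constant positive when K = 0.
  refine ⟨48 * K ^ 2 + 1, by positivity, ?_⟩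
  intro p hp A hgen
  set Γ := SimpleGraph.mulCayley (A : Set (Matrix.SpecialLinearGroup (Fin 2) (ZMod p))) with hΓ
  have hp2 : (2 : ℝ) ≤ p := by exact_mod_cast hp.out.two_le
  have hlp : Real.log 2 ≤ Real.log p := Real.log_le_log (by norm_num) hp2
  have hl2 := Real.log_two_gt_d9
  have hlp0 : 0 < Real.log p := by linarith
  have htop : Γ.ediam ≠ ⊤ := by
    have := SL2Growth.ediam_mulCayley_le (A := A) (SL2Growth.mem_pow_card hgen)
    exact ne_top_of_le_ne_top (ENat.natCast_ne_top _) this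
  have hnt : Nontrivial (Matrix.SpecialLinearGroup (Fin 2) (ZMod p)) :=
    ⟨SL2Growth.upper 1, 1, fun h => by
      have := congrArg (fun x : Matrix.SpecialLinearGroup (Fin 2) (ZMod p) => x.1 0 1) h
      simp [SL2Growth.upper_val] at this⟩
  have hA : A.Nonempty := by
    rw [Finset.nonempty_iff_ne_empty]
    rintro rfl
    rw [Finset.coe_empty, Subgroup.closure_empty] at hgen
    exact bot_ne_top hgen
  have hD0 : 0 < Γ.diam := Nat.pos_of_ne_zero (SimpleGraph.diam_ne_zero_of_ediam_ne_top htop)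
  obtain ⟨t, ht, hle⟩ := LazyWalk.exists_isMixingTime A hA Γ.diam hD0
    (SimpleGraph.connected_of_ediam_ne_top htop) fun u v => SimpleGraph.dist_le_diam htop
  refine ⟨t, ht, hle.trans ?_⟩
  set k : ℝ := ((A ∪ A⁻¹).card : ℝ) with hk
  set N : ℝ := (Fintype.card (Matrix.SpecialLinearGroup (Fin 2) (ZMod p)) : ℝ) with hN
  have hk1 : 1 ≤ k := by
    have : (A ∪ A⁻¹).Nonempty := hA.mono Finset.subset_union_left
    rw [hk]; exact_mod_cast this.card_pos
  have hkA : k ≤ 2 * A.card := by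
    have : (A ∪ A⁻¹).card ≤ 2 * A.card := by
      have := Finset.card_union_le A A⁻¹
      rw [Finset.card_inv] at this
      omega
    rw [hk]; exact_mod_cast this
  have hD1 : (1 : ℝ) ≤ Γ.diam := by exact_mod_cast hD0
  have hN1 : 1 ≤ N := by
    have : 0 < Fintype.card (Matrix.SpecialLinearGroup (Fin 2) (ZMod p)) := Fintype.card_pos
    rw [hN]; exact_mod_cast this
  have hN4 : N ≤ (p : ℝ) ^ 4 := by
    have := SL2Growth.card_SL2_le (K := ZMod p)
    rw [ZMod.card] at this
    rw [hN]; exact_mod_cast this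
  have hlogle : Real.log (4 * N) ≤ 6 * Real.log p := by
    calc Real.log (4 * N) ≤ Real.log ((p : ℝ) ^ 6) := by
          refine Real.log_le_log (by linarith) ?_
          have : (4 : ℝ) ≤ (p : ℝ) ^ 2 := by nlinarith
          calc 4 * N ≤ (p : ℝ) ^ 2 * (p : ℝ) ^ 4 := by gcongr
            _ = _ := by ring
      _ = _ := by rw [Real.log_pow]; norm_num
  have hlogge : 1 ≤ 2 * Real.log (4 * N) := by
    have h4 : Real.log 2 ≤ Real.log (4 * N) := Real.log_le_log (by norm_num) (by linarith)
    linarith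
  have hdiam := hK p A hgen
  have hkD : 1 ≤ k * (Γ.diam : ℝ) ^ 2 := by
    have := one_le_pow₀ hD1 (n := 2)
    nlinarith
  have hone : 1 ≤ 2 * k * (Γ.diam : ℝ) ^ 2 * Real.log (4 * N) := by
    calc (1 : ℝ) = 1 * 1 := by ring
      _ ≤ k * (Γ.diam : ℝ) ^ 2 * (2 * Real.log (4 * N)) := by gcongr
      _ = _ := by ring
  have hrpow : Real.log p ^ (2 * c + 1) = (Real.log p ^ c) ^ 2 * Real.log p := by
    rw [Real.rpow_add hlp0, Real.rpow_one, mul_comm 2 c, Real.rpow_mul hlp0.le, Real.rpow_two]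
  calc 2 * k * (Γ.diam : ℝ) ^ 2 * Real.log (4 * N) + 1
      ≤ 4 * k * (Γ.diam : ℝ) ^ 2 * Real.log (4 * N) := by linarith
    _ ≤ 4 * (2 * A.card) * (K * Real.log p ^ c) ^ 2 * (6 * Real.log p) := by
      have : 0 ≤ Real.log (4 * N) := by linarith
      gcongr
    _ = 48 * K ^ 2 * A.card * Real.log p ^ (2 * c + 1) := by rw [hrpow]; ring
    _ ≤ (48 * K ^ 2 + 1) * A.card * Real.log p ^ (2 * c + 1) := by
      have : 0 ≤ Real.log p ^ (2 * c + 1) := Real.rpow_nonneg hlp0.le _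
      gcongr
      linarith
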